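/- For complex $a,b,c$ and integers $m,n$ let $$W_{m,n}=W_{m,n}(a,b,c)={}_3F_2\!\left(\begin{matrix}a,\,b,\,c\\ \tfrac12(a+b+1+m),\;2c+n\end{matrix}\,\middle|\,1\right),\qquad s_{m,n}=\tfrac12(1+m-a-b)+c+n$$ ($s_{m,n}$ is the parametric excess). Assume throughout that none of $\tfrac12(a+b+1+m)$, $2c+n$, $s_{m,n}$ is in $\{0,-1,-2,\dots\}$; reciprocal gamma functions are read as $0$ at the poles of $\Gamma$. Then: (i) $$W_{0,-1}=\sqrt\pi\,\Gamma(c-\tfrac12)\,\Gamma(\tfrac{a+b+1}2)\,\Gamma(c-\tfrac{a+b+1}2)\left(\frac1{\Gamma(\frac{a+1}2)\Gamma(\frac{b+1}2)\Gamma(c-\frac{a+1}2)\Gamma(c-\frac{b+1}2)}+\frac1{\Gamma(\frac a2)\Gamma(\frac b2)\Gamma(c-\frac a2)\Gamma(c-\frac b2)}\right).$$ (ii) If $a\notin\{0,-1,-2,\dots\}$, $$W_{-1,1}=\frac{\sqrt\pi\,\Gamma(\frac{a+b}2)\,\Gamma(1+2c)\,\Gamma(1+c-\frac{a+b}2)}{2^{1+2c-a}\,\Gamma(c+1)\,\Gamma(a)}\left(\frac{\Gamma(\frac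 a2)}{\Gamma(1+c-\frac b2)\Gamma(c-\frac a2+\frac12)\Gamma(\frac b2)}+\frac{\Gamma(\frac{a+1}2)}{\Gamma(\frac12+c-\frac b2)\Gamma(c-\frac a2+1)\Gamma(\frac{b+1}2)}\right).$$ (iii) If $a\notin\{0,-1,-2,\dots\}$, $2c-a\notin\{0,-1,-2,\dots\}$, $a\ne b$ and $a+b\ne 2c$, $$W_{1,0}=\frac{\Gamma(1+\frac{a+b}2)\,\Gamma(2c)\,\Gamma(1+c-\frac{a+b}2)}{\Gamma(2c-a)\,\Gamma(c)\,\Gamma(a)\,\frac{b-a}2\,(c-\frac{a+b}2)}\left(\frac12\,\frac{\Gamma(c-\frac a2)\Gamma(\frac a2)}{\Gamma(c-\frac b2)\Gamma(\frac b2)}-\frac12\,\frac{\Gamma(c-\frac a2+\frac12)\Gamma(\frac{a+1}2)}{\Gamma(c-\frac b2+\frac12)\Gamma(\frac{b+1}2)}\right).$$ (iv) If $a\notin\{-1,-2,\dots\}$, $2c-b\notin\{0,-1,-2,\dots\}$ and $a\ne b$, $$W_{1,-1}=\frac{2^{a-b+2c-1}\,\Gamma(1+\frac{a+b}2)\,\Gamma(c-\frac{a+b}2)\,\Gamma(c-\frac12)}{\sqrt\pi\,\Gamma(a+1)\,\Gamma(2c-b)\,\frac{b-a}2}\left(\frac{\Gamma(1+\frac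 a2)\Gamma(c-\frac b2+\frac12)}{\Gamma(c-\frac a2-\frac12)\Gamma(\frac b2)}-\frac{a(2c-b-1)}4\,\frac{\Gamma(c-\frac b2)\Gamma(\frac{a+1}2)}{\Gamma(c-\frac a2)\Gamma(\frac{b+1}2)}\right).$$ Each identity holds in the following sense. Under the stated conditions, if $\operatorname{Re}s_{m,n}>0$ or the hypergeometric series terminates (one of $a,b,c$ is a nonpositive integer), then the series converges absolutely and its sum is the right-hand side. Moreover, the set of all $(a,b,c)\in\mathbb C^3$ satisfying the stated conditions is open and connected, the right-hand side is analytic on it, and it is there the analytic continuation of the sum $W_{m,n}$ from the nonempty open subset where $\operatorname{Re}s_{m,n}>0$. -/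

import Mathlib

open Complex

noncomputable section

/-- `z` is one of `0, -1, -2, …`, that is, a pole of the gamma function. -/
def IsNonposInt (z : ℂ) : Prop := ∃ k : ℕ, z = -(k : ℂ)

/-- The `k`-th term `(a)_k (b)_k (c)_k / ((e)_k (f)_k k!)` of the series `₃F₂(a, b, c; e, f | 1)`. -/
def hyp3F2Term (a b c e f : ℂ) (k : ℕ) : ℂ :=
  (ascPochhammer ℂ k).eval a * (ascPochhammer ℂ k).eval b * (ascPochhammer ℂ k).eval c /
    ((ascPochhammer ℂ k).eval e * (ascPochhammer ℂ k).eval f * (Nat.factorial k : ℂ))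

/-- First lower parameter of the contiguous Watson element `W_{m,n}`. -/
def watsonE (m : ℤ) (a b : ℂ) : ℂ := (a + b + 1 + m) / 2

/-- Second lower parameter of the contiguous Watson element `W_{m,n}`. -/
def watsonF (n : ℤ) (c : ℂ) : ℂ := 2 * c + n

/-- Parametric excess (sum of the lower minus sum of the upper parameters) of `W_{m,n}`. -/
def watsonExcess (m n : ℤ) (a b c : ℂ) : ℂ := watsonE m a b + watsonF n c - a - b - c

/-- The terms of the series `W_{m,n}(a, b, c)`. -/
def watsonTerm (m n : ℤ) (a b c : ℂ) (k : ℕ) : ℂ :=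
  hyp3F2Term a b c (watsonE m a b) (watsonF n c) k

/-- The sum `W_{m,n}(a, b, c) = ₃F₂(a, b, c; (a+b+1+m)/2, 2c+n | 1)` of the series. -/
def watsonW (m n : ℤ) (a b c : ℂ) : ℂ := ∑' k : ℕ, watsonTerm m n a b c k

/-- Lower parameters and excess are not nonpositive integers. -/
def WatsonRegular (m n : ℤ) (a b c : ℂ) : Prop :=
  ¬ IsNonposInt (watsonE m a b) ∧ ¬ IsNonposInt (watsonF n c) ∧
    ¬ IsNonposInt (watsonExcess m n a b c)

/-- `g` on the domain `R` is the analytic continuation of `f` on the nonempty open subset `U`. -/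
def IsAnalyticContinuation (g : ℂ × ℂ × ℂ → ℂ) (R : Set (ℂ × ℂ × ℂ))
    (f : ℂ × ℂ × ℂ → ℂ) (U : Set (ℂ × ℂ × ℂ)) : Prop :=
  IsOpen U ∧ U.Nonempty ∧ U ⊆ R ∧ IsOpen R ∧ IsConnected R ∧ AnalyticOnNhd ℂ g R ∧ Set.EqOn f g U

/-- `W_{m,n}(a, b, c) = G a b c` for all `(a, b, c)` with `P a b c`: the series has that sum
whenever its excess has positive real part or it terminates, and `G` is the analytic continuation
of `W_{m,n}` to the whole set of parameters with `P a b c`. -/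
def WatsonEvaluation (m n : ℤ) (P : ℂ → ℂ → ℂ → Prop) (G : ℂ → ℂ → ℂ → ℂ) : Prop :=
  (∀ a b c : ℂ, P a b c →
    (0 < (watsonExcess m n a b c).re ∨ IsNonposInt a ∨ IsNonposInt b ∨ IsNonposInt c) →
      HasSum (watsonTerm m n a b c) (G a b c)) ∧
  IsAnalyticContinuation
    (fun p => G p.1 p.2.1 p.2.2)
    {p | P p.1 p.2.1 p.2.2}
    (fun p => watsonW m n p.1 p.2.1 p.2.2)
    {p | P p.1 p.2.1 p.2.2 ∧ 0 < (watsonExcess m n p.1 p.2.1 p.2.2).re}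

/- In the four closed forms, Mathlib's `Gamma` is `0` at its poles, so a reciprocal gamma factor
is correctly `0` there. -/

/-- Closed form of `W_{0,-1}`. -/
def watsonZeroNegOne (a b c : ℂ) : ℂ :=
  (Real.sqrt Real.pi : ℂ) * Gamma (c - 1 / 2) * Gamma (a / 2 + b / 2 + 1 / 2) *
      Gamma (c - a / 2 - b / 2 - 1 / 2) *
    (1 / (Gamma (a / 2 + 1 / 2) * Gamma (b / 2 + 1 / 2) *
          Gamma (c - 1 / 2 - a / 2) * Gamma (c - 1 / 2 - b / 2)) +
      1 / (Gamma (a / 2) * Gamma (b / 2) * Gamma (c - a / 2) * Gamma (c - b / 2)))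

/-- Closed form of `W_{-1,1}`. -/
def watsonNegOneOne (a b c : ℂ) : ℂ :=
  (Gamma (a / 2) / (Gamma (1 + c - b / 2) * Gamma (c - a / 2 + 1 / 2) * Gamma (b / 2)) +
      Gamma (a / 2 + 1 / 2) /
        (Gamma (1 / 2 + c - b / 2) * Gamma (c - a / 2 + 1) * Gamma (b / 2 + 1 / 2))) *
    ((Real.sqrt Real.pi : ℂ) * Gamma (a / 2 + b / 2) * Gamma (1 + 2 * c) *
      Gamma (1 + c - a / 2 - b / 2)) /
    ((2 : ℂ) ^ (1 + 2 * c - a) * Gamma (c + 1) * Gamma a)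

/-- Closed form of `W_{1,0}`. -/
def watsonOneZero (a b c : ℂ) : ℂ :=
  (1 / 2 * (Gamma (c - a / 2) * Gamma (a / 2) / (Gamma (c - b / 2) * Gamma (b / 2))) -
      1 / 2 * (Gamma (1 / 2 - a / 2 + c) * Gamma (a / 2 + 1 / 2) /
        (Gamma (1 / 2 - b / 2 + c) * Gamma (b / 2 + 1 / 2)))) *
    Gamma (1 + a / 2 + b / 2) * Gamma (2 * c) * Gamma (1 + c - a / 2 - b / 2) /
    (Gamma (2 * c - a) * Gamma c * Gamma a * (b / 2 - a / 2) * (c - a / 2 - b / 2))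

/-- Closed form of `W_{1,-1}`. -/
def watsonOneNegOne (a b c : ℂ) : ℂ :=
  (-(1 / 4) * (a * (2 * c - b - 1) * Gamma (c - b / 2) * Gamma (a / 2 + 1 / 2) /
        (Gamma (c - a / 2) * Gamma (b / 2 + 1 / 2))) +
      Gamma (1 + a / 2) * Gamma (c - b / 2 + 1 / 2) /
        (Gamma (c - a / 2 - 1 / 2) * Gamma (b / 2))) *
    Gamma (1 + a / 2 + b / 2) * Gamma (c - a / 2 - b / 2) * Gamma (c - 1 / 2) *
      (2 : ℂ) ^ (a - b + 2 * c - 1) /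
    ((Real.sqrt Real.pi : ℂ) * Gamma (a + 1) * Gamma (2 * c - b) * (b / 2 - a / 2))

end

/-!
The four series are evaluated by analytic continuation from the region where `a` and `b` have very
negative real part and `c` has large real part, in which every series involved converges.

*Watson's theorem.* For the series `W(a, b, c) = W_{0,0}(a, b, c)` a telescoping relation gives
`W(a, b, c + 1)` as an elementary multiple of `W(a, b, c)` (`watson_recurrence`). Iterating it, and
passing to the limit `c → ∞` by dominated convergence, shows that `W(a, b, c)` is an explicit
quotient of gamma functions times a number depending on `a` and `b` only
(`tsum_watson_eq_mul_limit`). That number is found at `c = 1`, where the series is a Gauss series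
with parameters `a - 1`, `b - 1` and its first term removed (`watson_limit`). Gauss's theorem itself
is proved by the same method (`tsum_gauss`).

*Contiguous relations.* Changing `2 c` to `2 c ± 1` adds a multiple of `W(a + 1, b + 1, ·)`, and
`(b - a) W_{1,n}` and `(a + b) W_{-1,n}` are combinations of `W_{0,n}(a + 1, b, c)` and
`W_{0,n}(a, b + 1, c)`. With the functional equation and the duplication formula for `Γ`, these give
the closed forms in the region described above.

*Continuation.* The terms of a series with excess `s` are `O(k ^ (-1 - Re s))`, locally uniformly in
the parameters (`exists_norm_hyp3F2Term_le`), so the sum is holomorphic along every complex line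
where `Re s > 0`. The conditions on the parameters exclude countably many hyperplanes, so a line
through an admissible point contains only countably many excluded points (`LineGeneric`), and a
plane or half-plane minus a countable set is connected. The identity theorem on suitable lines
therefore transports the closed form to all parameters with `Re s > 0` (`watsonW_eq_of_base`) and
then to the terminating series (`hasSum_watsonTerm_of_terminating`).
-/

open Filter Topology

/-! ### Size of the terms -/

theorem hyp3F2Term_zero (a b c e f : ℂ) : hyp3F2Term a b c e f 0 = 1 := by
  simp [hyp3F2Term]

theorem hyp3F2Term_succ (a b c e f : ℂ) (k : ℕ) :
    hyp3F2Term a b c e f (k + 1) = hyp3F2Term a b c e f k *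
      ((a + k) * (b + k) * (c + k) / ((e + k) * (f + k) * (k + 1))) := by
  simp only [hyp3F2Term, ascPochhammer_succ_eval, Nat.factorial_succ, Nat.cast_mul, Nat.cast_succ]
  rw [div_mul_div_comm]
  congr 1 <;> ring

theorem abs_re_log_one_add_sub_re_le {w : ℂ} (hw : ‖w‖ ≤ 1 / 2) :
    |(log (1 + w)).re - w.re| ≤ ‖w‖ ^ 2 := by
  have h := Complex.norm_log_one_add_sub_self_le (z := w) (by linarith)
  have h1 : (1 - ‖w‖)⁻¹ ≤ 2 := by
    rw [inv_le_comm₀ (by linarith) (by norm_num)]; linarith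
  have h2 : ‖w‖ ^ 2 * (1 - ‖w‖)⁻¹ / 2 ≤ ‖w‖ ^ 2 := by
    nlinarith [sq_nonneg ‖w‖]
  have h3 := Complex.abs_re_le_norm (log (1 + w) - w)
  rw [Complex.sub_re] at h3
  linarith

/-- To first order in `1 / x`, the norm of `z + x` is `x * exp (z.re / x)`, with an error
controlled by a bound `R` for the norm of `z`. -/
theorem norm_add_ofReal_mem_Icc {R x : ℝ} {z : ℂ} (hz : ‖z‖ ≤ R) (hx : 2 * R ≤ x) (hx0 : 0 < x) :
    x * Real.exp (z.re / x - R ^ 2 / x ^ 2) ≤ ‖z + x‖ ∧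
      ‖z + x‖ ≤ x * Real.exp (z.re / x + R ^ 2 / x ^ 2) := by
  have hw : ‖z / x‖ = ‖z‖ / x := by
    rw [norm_div, Complex.norm_real, Real.norm_of_nonneg hx0.le]
  have hw2 : ‖z / x‖ ≤ 1 / 2 := by
    rw [hw, div_le_iff₀ hx0]; linarith
  have hre : (z / x).re = z.re / x := Complex.div_ofReal_re z x
  have hsq : ‖z / x‖ ^ 2 ≤ R ^ 2 / x ^ 2 := by
    rw [hw, div_pow]
    gcongr
  have key := abs_le.1 (abs_re_log_one_add_sub_re_le hw2)
  rw [hre] at key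
  have hne : 1 + z / x ≠ 0 := by
    intro h
    have : z / x = -1 := by linear_combination h
    rw [this] at hw2
    norm_num at hw2
  have hn : ‖z + x‖ = x * Real.exp (log (1 + z / x)).re := by
    rw [← Complex.norm_exp, Complex.exp_log hne]
    have hxc : (x : ℂ) ≠ 0 := by exact_mod_cast hx0.ne'
    have : z + x = x * (1 + z / x) := by field_simp; ring
    rw [this, norm_mul, Complex.norm_real, Real.norm_of_nonneg hx0.le]
  rw [hn]
  constructor <;> gcongr <;> linarith

/-- The quotient of two consecutive terms is at most `1 - (1 + s) / x` up to `O(x ^ (-2))`, where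
`s` is the parametric excess; the error is uniform in the parameters. -/
theorem norm_hyp3F2_ratio_le {R σ x : ℝ} {a b c e f : ℂ} (ha : ‖a‖ ≤ R) (hb : ‖b‖ ≤ R)
    (hc : ‖c‖ ≤ R) (he : ‖e‖ ≤ R) (hf : ‖f‖ ≤ R) (h1 : 1 ≤ R) (hσ : σ ≤ (e + f - a - b - c).re)
    (hx : 2 * R ≤ x) :
    ‖(a + x) * (b + x) * (c + x) / ((e + x) * (f + x) * (x + 1))‖ ≤
      Real.exp (-(1 + σ) / x + 6 * R ^ 2 / x ^ 2) := by
  have hx0 : 0 < x := by linarith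
  have A := (norm_add_ofReal_mem_Icc ha hx hx0).2
  have B := (norm_add_ofReal_mem_Icc hb hx hx0).2
  have C := (norm_add_ofReal_mem_Icc hc hx hx0).2
  have E := (norm_add_ofReal_mem_Icc he hx hx0).1
  have F := (norm_add_ofReal_mem_Icc hf hx hx0).1
  have O := (norm_add_ofReal_mem_Icc (z := 1) (by simpa using h1) hx hx0).1
  rw [norm_div, norm_mul, norm_mul, norm_mul, norm_mul, add_comm (x : ℂ) 1]
  calc _ ≤ (x * Real.exp (a.re / x + R ^ 2 / x ^ 2)) * (x * Real.exp (b.re / x + R ^ 2 / x ^ 2)) *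
          (x * Real.exp (c.re / x + R ^ 2 / x ^ 2)) /
          ((x * Real.exp (e.re / x - R ^ 2 / x ^ 2)) * (x * Real.exp (f.re / x - R ^ 2 / x ^ 2)) *
          (x * Real.exp ((1 : ℂ).re / x - R ^ 2 / x ^ 2))) := by gcongr
    _ = Real.exp (-(1 + (e + f - a - b - c).re) / x + 6 * R ^ 2 / x ^ 2) := by
      rw [div_eq_iff (by positivity)]
      have : ∀ u v w : ℝ, (x * Real.exp u) * (x * Real.exp v) * (x * Real.exp w) =
          x ^ 3 * Real.exp (u + v + w) := by
        intro u v w; rw [Real.exp_add, Real.exp_add]; ring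
      rw [this, this, mul_left_comm, ← Real.exp_add]
      congr 2
      simp only [Complex.sub_re, Complex.add_re, Complex.one_re]
      field_simp
      ring
    _ ≤ _ := by gcongr

/-- A quantitative form of Raabe's test. -/
theorem le_mul_rpow_neg_of_ratio_le {u : ℕ → ℝ} {p C : ℝ} {K : ℕ} (hp : 0 ≤ p) (hC : 0 ≤ C)
    (hK : 2 ≤ K) (hu : ∀ k, 0 ≤ u k)
    (h : ∀ k, K ≤ k → u (k + 1) ≤ u k * Real.exp (-p / k + C / k ^ 2)) (k : ℕ) (hk : K ≤ k) :
    u k ≤ u K * (K ^ p * Real.exp C) * (k : ℝ) ^ (-p) := by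
  -- `u k * k ^ p * exp (C / (k - 1))` is decreasing, because `1 / k ^ 2 ≤ 1 / (k - 1) - 1 / k`
  have mono : ∀ k, K ≤ k → u k * (k : ℝ) ^ p * Real.exp (C / (k - 1)) ≤
      u K * (K : ℝ) ^ p * Real.exp (C / (K - 1)) := by
    intro k hk
    induction k, hk using Nat.le_induction with
    | base => exact le_rfl
    | succ k hk ih =>
      refine le_trans ?_ ih
      have hk1 : (1 : ℝ) < k := by exact_mod_cast (by omega : 1 < k)
      have hpow : ((k : ℝ) + 1) ^ p ≤ (k : ℝ) ^ p * Real.exp (p / k) := by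
        have h1 : (k : ℝ) + 1 = k * (1 / k + 1) := by field_simp; ring
        rw [h1, Real.mul_rpow (by positivity) (by positivity)]
        gcongr
        calc (1 / (k : ℝ) + 1) ^ p ≤ (Real.exp (1 / k)) ^ p := by
              gcongr
              exact Real.add_one_le_exp _
          _ = Real.exp (p / k) := by rw [← Real.exp_mul]; congr 1; ring
      have hexp : C / (k : ℝ) ^ 2 + C / k ≤ C / (k - 1) := by
        have : C / (k - 1) - (C / (k : ℝ) ^ 2 + C / k) = C / (k ^ 2 * (k - 1)) := by
          have : (k : ℝ) - 1 ≠ 0 := by linarith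
          field_simp
          ring
        have h2 : 0 ≤ C / ((k : ℝ) ^ 2 * (k - 1)) := by
          have : (0 : ℝ) < k - 1 := by linarith
          positivity
        linarith
      push_cast
      rw [add_sub_cancel_right]
      have huk := hu k
      calc u (k + 1) * ((k : ℝ) + 1) ^ p * Real.exp (C / k)
          ≤ (u k * Real.exp (-p / k + C / k ^ 2)) * ((k : ℝ) ^ p * Real.exp (p / k)) *
            Real.exp (C / k) := by
            gcongr
            exact h k hk
        _ = u k * (k : ℝ) ^ p * Real.exp (C / k ^ 2 + C / k) := by
            have : Real.exp (C / k ^ 2 + C / k) =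
                Real.exp (-p / k + C / k ^ 2) * Real.exp (p / k) * Real.exp (C / k) := by
              rw [← Real.exp_add, ← Real.exp_add]; congr 1; ring
            rw [this]; ring
        _ ≤ _ := by gcongr
  have hk0 : (0 : ℝ) < k := by exact_mod_cast (by omega : 0 < k)
  have hk1 : (0 : ℝ) ≤ (k : ℝ) - 1 := by
    have : (1 : ℝ) ≤ k := by exact_mod_cast (by omega : 1 ≤ k)
    linarith
  have hK1 : (1 : ℝ) ≤ (K : ℝ) - 1 := by
    have : (2 : ℝ) ≤ K := by exact_mod_cast hK
    linarith
  rw [Real.rpow_neg hk0.le, ← div_eq_mul_inv, le_div_iff₀ (by positivity)]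
  have huk := hu k
  have huK := hu K
  calc u k * (k : ℝ) ^ p ≤ u k * (k : ℝ) ^ p * Real.exp (C / (k - 1)) :=
        le_mul_of_one_le_right (by positivity) (Real.one_le_exp (by positivity))
    _ ≤ _ := mono k hk
    _ ≤ u K * (K : ℝ) ^ p * Real.exp C := by
        gcongr
        exact div_le_self hC hK1
    _ = _ := by ring

/-- Beyond an index that depends only on a bound for the parameters, the terms are dominated by
`k ^ (-(1 + σ))` as soon as the excess has real part at least `σ`. -/
theorem exists_norm_hyp3F2Term_le (R σ : ℝ) (hσ : 0 ≤ σ) :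
    ∃ (K : ℕ) (C : ℝ), 2 ≤ K ∧ 0 ≤ C ∧ ∀ a b c e f : ℂ, ‖a‖ ≤ R → ‖b‖ ≤ R → ‖c‖ ≤ R → ‖e‖ ≤ R →
      ‖f‖ ≤ R → σ ≤ (e + f - a - b - c).re → ∀ k, K ≤ k →
        ‖hyp3F2Term a b c e f k‖ ≤ ‖hyp3F2Term a b c e f K‖ * C * (k : ℝ) ^ (-(1 + σ)) := by
  set S := max R 1 with hS
  obtain ⟨K, hK⟩ := exists_nat_ge (2 * S)
  have hS1 : 1 ≤ S := le_max_right _ _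
  have hRS : R ≤ S := le_max_left _ _
  have hK2 : 2 ≤ K := by
    have : (2 : ℝ) ≤ K := by linarith
    exact_mod_cast this
  refine ⟨K, K ^ (1 + σ) * Real.exp (6 * S ^ 2), hK2, by positivity, ?_⟩
  intro a b c e f ha hb hc he hf hs
  refine le_mul_rpow_neg_of_ratio_le (u := fun k => ‖hyp3F2Term a b c e f k‖)
    (by linarith) (by positivity) hK2 (fun k => norm_nonneg _) ?_
  intro k hk
  have hkK : (K : ℝ) ≤ k := by exact_mod_cast hk
  have := norm_hyp3F2_ratio_le (x := k) (ha.trans hRS) (hb.trans hRS) (hc.trans hRS)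
    (he.trans hRS) (hf.trans hRS) hS1 hs (by linarith)
  rw [hyp3F2Term_succ, norm_mul]
  gcongr
  exact_mod_cast this

theorem exists_norm_hyp3F2Term_le_of_excess {a b c e f : ℂ} (h : 0 < (e + f - a - b - c).re) :
    ∃ C : ℝ, ∃ p : ℝ, 1 < p ∧ ∀ᶠ k : ℕ in atTop, ‖hyp3F2Term a b c e f k‖ ≤ C * (k : ℝ) ^ (-p) := by
  obtain ⟨K, C, -, -, hKC⟩ := exists_norm_hyp3F2Term_le
    (max (max ‖a‖ ‖b‖) (max ‖c‖ (max ‖e‖ ‖f‖))) (e + f - a - b - c).re h.le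
  refine ⟨_, 1 + (e + f - a - b - c).re, by linarith, eventually_atTop.2 ⟨K, fun k hk =>
    hKC a b c e f ?_ ?_ ?_ ?_ ?_ le_rfl k hk⟩⟩ <;> simp

theorem summable_hyp3F2Term {a b c e f : ℂ} (h : 0 < (e + f - a - b - c).re) :
    Summable (hyp3F2Term a b c e f) := by
  obtain ⟨C, p, hp, hC⟩ := exists_norm_hyp3F2Term_le_of_excess h
  refine Summable.of_norm_bounded_eventually_nat
    (g := fun k : ℕ => C * (k : ℝ) ^ (-p)) ?_ hC
  exact (Real.summable_nat_rpow.2 (by linarith)).mul_left C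

theorem tendsto_nat_mul_hyp3F2Term {a b c e f : ℂ} (h : 0 < (e + f - a - b - c).re) :
    Tendsto (fun k : ℕ => (k : ℂ) * hyp3F2Term a b c e f k) atTop (𝓝 0) := by
  obtain ⟨C, p, hp, hC⟩ := exists_norm_hyp3F2Term_le_of_excess h
  have hlim : Tendsto (fun k : ℕ => C * (k : ℝ) ^ (-(p - 1))) atTop (𝓝 0) := by
    simpa using ((tendsto_rpow_neg_atTop (show 0 < p - 1 by linarith)).comp
      tendsto_natCast_atTop_atTop).const_mul C
  refine squeeze_zero_norm' ?_ hlim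
  filter_upwards [hC, eventually_gt_atTop 0] with k hk hk0
  have hk0' : (0 : ℝ) < k := by exact_mod_cast hk0
  rw [norm_mul, Complex.norm_natCast]
  calc (k : ℝ) * ‖hyp3F2Term a b c e f k‖ ≤ k * (C * (k : ℝ) ^ (-p)) := by gcongr
    _ = C * (k : ℝ) ^ (-(p - 1)) := by
      rw [show -(p - 1) = 1 + -p by ring, Real.rpow_add hk0', Real.rpow_one]; ring

theorem ascPochhammer_eval_ne_zero {z : ℂ} (hz : ¬ IsNonposInt z) (k : ℕ) :
    (ascPochhammer ℂ k).eval z ≠ 0 := by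
  rw [Ne, ascPochhammer_eval_eq_zero_iff]
  rintro ⟨j, -, hj⟩
  exact hz ⟨j, by rw [hj]; simp⟩

theorem differentiableAt_hyp3F2Term {a b c e f : ℂ → ℂ} {t : ℂ} (ha : DifferentiableAt ℂ a t)
    (hb : DifferentiableAt ℂ b t) (hc : DifferentiableAt ℂ c t) (he : DifferentiableAt ℂ e t)
    (hf : DifferentiableAt ℂ f t) (he0 : ¬ IsNonposInt (e t)) (hf0 : ¬ IsNonposInt (f t)) (k : ℕ) :
    DifferentiableAt ℂ (fun t => hyp3F2Term (a t) (b t) (c t) (e t) (f t) k) t := by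
  have P : ∀ {g : ℂ → ℂ}, DifferentiableAt ℂ g t →
      DifferentiableAt ℂ (fun t => (ascPochhammer ℂ k).eval (g t)) t := fun {g} hg =>
    ((ascPochhammer ℂ k).differentiable (𝕜 := ℂ) (g t)).comp t hg
  refine (((P ha).mul (P hb)).mul (P hc)).div (((P he).mul (P hf)).mul_const _) ?_
  have := ascPochhammer_eval_ne_zero he0 k
  have := ascPochhammer_eval_ne_zero hf0 k
  have : (Nat.factorial k : ℂ) ≠ 0 := by exact_mod_cast k.factorial_ne_zero
  simp [*]

/-- The sum of the series depends holomorphically on its parameters. -/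
theorem differentiableOn_tsum_hyp3F2Term {a b c e f : ℂ → ℂ} {U : Set ℂ} (hU : IsOpen U)
    (ha : Differentiable ℂ a) (hb : Differentiable ℂ b) (hc : Differentiable ℂ c)
    (he : Differentiable ℂ e) (hf : Differentiable ℂ f) (he0 : ∀ t ∈ U, ¬ IsNonposInt (e t))
    (hf0 : ∀ t ∈ U, ¬ IsNonposInt (f t)) (hs : ∀ t ∈ U, 0 < (e t + f t - a t - b t - c t).re) :
    DifferentiableOn ℂ (fun t => ∑' k, hyp3F2Term (a t) (b t) (c t) (e t) (f t) k) U := by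
  intro t₀ ht₀
  apply DifferentiableAt.differentiableWithinAt
  set σ := (e t₀ + f t₀ - a t₀ - b t₀ - c t₀).re / 2 with hσ
  have hσ0 : 0 < σ := half_pos (hs t₀ ht₀)
  set R := 1 + max (max ‖a t₀‖ ‖b t₀‖) (max ‖c t₀‖ (max ‖e t₀‖ ‖f t₀‖)) with hR
  obtain ⟨K, C, hK2, hC0, hKC⟩ := exists_norm_hyp3F2Term_le R σ hσ0.le
  have term := fun t ht k => differentiableAt_hyp3F2Term (ha t) (hb t) (hc t) (he t) (hf t)
    (he0 t ht) (hf0 t ht) k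
  set M := ‖hyp3F2Term (a t₀) (b t₀) (c t₀) (e t₀) (f t₀) K‖ + 1 with hM
  have near : ∀ {g : ℂ → ℂ}, Differentiable ℂ g → ‖g t₀‖ < R → ∀ᶠ t in 𝓝 t₀, ‖g t‖ < R :=
    fun hg h => (hg.continuous.norm.tendsto t₀).eventually_lt_const h
  have hall : ∀ᶠ t in 𝓝 t₀, t ∈ U ∧ ‖a t‖ < R ∧ ‖b t‖ < R ∧ ‖c t‖ < R ∧ ‖e t‖ < R ∧ ‖f t‖ < R ∧
      σ < (e t + f t - a t - b t - c t).re ∧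
      ‖hyp3F2Term (a t) (b t) (c t) (e t) (f t) K‖ < M := by
    have hcont : Continuous fun t => (e t + f t - a t - b t - c t).re := by
      have := ha.continuous; have := hb.continuous; have := hc.continuous
      have := he.continuous; have := hf.continuous
      fun_prop
    have hlt : ∀ x ≤ max (max ‖a t₀‖ ‖b t₀‖) (max ‖c t₀‖ (max ‖e t₀‖ ‖f t₀‖)), x < R :=
      fun x hx => by linarith
    refine (hU.eventually_mem ht₀).and <| (near ha (hlt _ ?_)).and <| (near hb (hlt _ ?_)).and <|
      (near hc (hlt _ ?_)).and <| (near he (hlt _ ?_)).and <| (near hf (hlt _ ?_)).and <|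
      ((hcont.tendsto t₀).eventually_const_lt (by linarith [hs t₀ ht₀])).and <|
      ((term t₀ ht₀ K).continuousAt.norm.tendsto.eventually_lt_const (lt_add_one _))
    all_goals simp
  obtain ⟨V, hV, hVo, htV⟩ := eventually_nhds_iff.1 hall
  have htail : DifferentiableOn ℂ
      (fun t => ∑' k, hyp3F2Term (a t) (b t) (c t) (e t) (f t) (k + K)) V := by
    refine differentiableOn_tsum_of_summable_norm
      (u := fun k : ℕ => M * C * ((k + K : ℕ) : ℝ) ^ (-(1 + σ))) ?_ ?_ hVo ?_
    · exact ((summable_nat_add_iff K).2 (Real.summable_nat_rpow.2 (by linarith))).mul_left _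
    · exact fun k t ht => (term t (hV t ht).1 _).differentiableWithinAt
    · intro k t ht
      obtain ⟨-, h1, h2, h3, h4, h5, h6, h7⟩ := hV t ht
      refine (hKC _ _ _ _ _ h1.le h2.le h3.le h4.le h5.le h6.le (k + K) (by omega)).trans ?_
      gcongr
  have hfin : DifferentiableAt ℂ
      (fun t => ∑ k ∈ Finset.range K, hyp3F2Term (a t) (b t) (c t) (e t) (f t) k) t₀ :=
    DifferentiableAt.fun_sum fun k _ => term t₀ ht₀ k
  refine (hfin.add (htail.differentiableAt (hVo.mem_nhds htV))).congr_of_eventuallyEq ?_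
  filter_upwards [hVo.mem_nhds htV] with t ht
  exact ((summable_hyp3F2Term (hs t (hV t ht).1)).sum_add_tsum_nat_add K).symm

/-! ### Telescoping, iteration and the limits involved -/

theorem ascPochhammer_eval_mul_add (z : ℂ) (k : ℕ) :
    (ascPochhammer ℂ k).eval z * (z + k) = z * (ascPochhammer ℂ k).eval (z + 1) := by
  rw [← ascPochhammer_succ_eval, ascPochhammer_succ_left]
  simp

theorem add_natCast_ne_zero {z : ℂ} (hz : ¬ IsNonposInt z) (k : ℕ) : z + k ≠ 0 :=
  fun h => hz ⟨k, by linear_combination h⟩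

theorem not_isNonposInt_of_re_pos {z : ℂ} (hz : 0 < z.re) : ¬ IsNonposInt z := by
  rintro ⟨k, rfl⟩
  have : (0 : ℝ) ≤ k := k.cast_nonneg
  simp at hz
  linarith

theorem IsNonposInt.sub_natCast {z : ℂ} (hz : IsNonposInt z) (n : ℕ) : IsNonposInt (z - n) := by
  obtain ⟨k, rfl⟩ := hz
  exact ⟨k + n, by push_cast; ring⟩

theorem not_isNonposInt_add_natCast {z : ℂ} (hz : ¬ IsNonposInt z) (n : ℕ) :
    ¬ IsNonposInt (z + n) := fun h => hz (by simpa using h.sub_natCast n)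

/-- Summation of a telescoping relation between two series. -/
theorem mul_tsum_eq_mul_tsum_of_telescoping {u v g : ℕ → ℂ} {α β : ℂ} (hu : Summable u)
    (hv : Summable v) (hg0 : g 0 = 0) (hg : Tendsto g atTop (𝓝 0))
    (h : ∀ k, α * u k - β * v k = g (k + 1) - g k) : α * ∑' k, u k = β * ∑' k, v k := by
  have h1 : HasSum (fun k => α * u k - β * v k) (α * ∑' k, u k - β * ∑' k, v k) :=
    (hu.hasSum.mul_left α).sub (hv.hasSum.mul_left β)
  have h2 := h1.tendsto_sum_nat
  simp_rw [h, Finset.sum_range_sub, hg0, sub_zero] at h2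
  exact sub_eq_zero.1 (tendsto_nhds_unique h2 hg)

/-- Solution of a first-order recurrence from the behaviour of `S` at infinity. The product has
`n + 1` factors so that it matches the number of factors in `Complex.GammaSeq`. -/
theorem eq_mul_of_iterate {S r : ℕ → ℂ} {P L : ℂ} (h : ∀ n, S n = r n * S (n + 1))
    (hS : Tendsto S atTop (𝓝 L))
    (hr : Tendsto (fun n => ∏ j ∈ Finset.range (n + 1), r j) atTop (𝓝 P)) : S 0 = P * L := by
  have h1 : ∀ n, S 0 = (∏ j ∈ Finset.range n, r j) * S n := by
    intro n
    induction n with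
    | zero => simp
    | succ n ih => rw [ih, h n, Finset.prod_range_succ, mul_assoc]
  have h2 := hr.mul (hS.comp (tendsto_add_atTop_nat 1))
  refine tendsto_nhds_unique (f := fun _ : ℕ => S 0) tendsto_const_nhds (h2.congr fun n => ?_)
  exact (h1 (n + 1)).symm

/-- This holds at the poles of `Γ` as well: there, `GammaSeq` is eventually `0`. -/
theorem tendsto_GammaSeq_inv (z : ℂ) :
    Tendsto (fun n => (GammaSeq z n)⁻¹) atTop (𝓝 (Gamma z)⁻¹) := by
  by_cases hz : Gamma z = 0
  · obtain ⟨m, rfl⟩ := (Complex.Gamma_eq_zero_iff z).1 hz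
    rw [hz, inv_zero]
    refine tendsto_const_nhds.congr' ?_
    filter_upwards [eventually_ge_atTop m] with n hn
    rw [GammaSeq, Finset.prod_eq_zero (Finset.mem_range.2 (Nat.lt_succ_of_le hn)) (by simp)]
    simp
  · exact (GammaSeq_tendsto_Gamma z).inv₀ hz

/-- Evaluation of a convergent infinite product by Euler's limit formula for `Γ`. -/
theorem tendsto_prod_ratio {z₁ z₂ z₃ z₄ : ℂ} (h : z₁ + z₂ = z₃ + z₄) :
    Tendsto (fun n : ℕ => ∏ j ∈ Finset.range (n + 1),
      ((z₁ + j) * (z₂ + j) / ((z₃ + j) * (z₄ + j)))) atTop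
      (𝓝 (Gamma z₃ * Gamma z₄ / (Gamma z₁ * Gamma z₂))) := by
  have lim := ((GammaSeq_tendsto_Gamma z₃).mul (GammaSeq_tendsto_Gamma z₄)).mul
    ((tendsto_GammaSeq_inv z₁).mul (tendsto_GammaSeq_inv z₂))
  rw [div_eq_mul_inv, mul_inv]
  refine lim.congr' ?_
  filter_upwards [eventually_gt_atTop 0] with n hn
  have hn0 : (n : ℂ) ≠ 0 := by exact_mod_cast hn.ne'
  have hf : (n.factorial : ℂ) ≠ 0 := by exact_mod_cast n.factorial_ne_zero
  have hp : ∀ z : ℂ, (n : ℂ) ^ z ≠ 0 := fun z => by simp [hn0]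
  have hpow : (n : ℂ) ^ z₁ * (n : ℂ) ^ z₂ = (n : ℂ) ^ z₃ * (n : ℂ) ^ z₄ := by
    rw [← cpow_add _ _ hn0, ← cpow_add _ _ hn0, h]
  rw [Finset.prod_div_distrib, Finset.prod_mul_distrib, Finset.prod_mul_distrib]
  simp only [GammaSeq]
  have h1 := hp z₁
  have h2 := hp z₂
  calc _ = ((n : ℂ) ^ z₃ * (n : ℂ) ^ z₄) / ((n : ℂ) ^ z₁ * (n : ℂ) ^ z₂) *
        ((n.factorial : ℂ) / n.factorial) ^ 2 *
        ((∏ j ∈ Finset.range (n + 1), (z₁ + j)) * (∏ j ∈ Finset.range (n + 1), (z₂ + j)) /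
        ((∏ j ∈ Finset.range (n + 1), (z₃ + j)) * ∏ j ∈ Finset.range (n + 1), (z₄ + j))) := by
          simp only [div_eq_mul_inv, mul_inv, inv_inv]
          ring
    _ = _ := by
      rw [← hpow, div_self (mul_ne_zero h1 h2), div_self hf]
      simp

theorem norm_hyp3F2Term_le_of_ratio_le {a b c e f a' b' c' e' f' : ℂ}
    (h : ∀ k : ℕ, ‖(a + k) * (b + k) * (c + k) / ((e + k) * (f + k) * (k + 1))‖ ≤
      ‖(a' + k) * (b' + k) * (c' + k) / ((e' + k) * (f' + k) * (k + 1))‖) (k : ℕ) :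
    ‖hyp3F2Term a b c e f k‖ ≤ ‖hyp3F2Term a' b' c' e' f' k‖ := by
  induction k with
  | zero => simp [hyp3F2Term_zero]
  | succ k ih =>
    rw [hyp3F2Term_succ, hyp3F2Term_succ, norm_mul, norm_mul]
    gcongr
    exact h k

theorem tendsto_inv_add_natCast (z : ℂ) : Tendsto (fun n : ℕ => (z + n)⁻¹) atTop (𝓝 0) := by
  refine tendsto_inv₀_cobounded.comp ?_
  refine (tendsto_const_add_cobounded z).comp ?_
  rw [← tendsto_norm_atTop_iff_cobounded]
  simpa using! tendsto_natCast_atTop_atTop (R := ℝ)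

/-! ### Gauss's summation theorem -/

theorem gauss_recurrence {a b e : ℂ} (he : ¬ IsNonposInt e) (hs : 0 < (e - a - b).re) :
    (e - a) * (e - b) * ∑' k, hyp3F2Term a b 1 (e + 1) 1 k =
      e * (e - a - b) * ∑' k, hyp3F2Term a b 1 e 1 k := by
  have hs0 : 0 < (e + 1 - a - b - 1).re := by simp at hs ⊢; linarith
  have hs1 : 0 < (e + 1 + 1 - a - b - 1).re := by simp at hs ⊢; linarith
  refine mul_tsum_eq_mul_tsum_of_telescoping (g := fun k => e * (k * hyp3F2Term a b 1 e 1 k))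
    (summable_hyp3F2Term hs1) (summable_hyp3F2Term hs0) (by simp) ?_ fun k => ?_
  · simpa using (tendsto_nat_mul_hyp3F2Term hs0).const_mul e
  · have hek := add_natCast_ne_zero he k
    have hk1 : (k : ℂ) + 1 ≠ 0 := by exact_mod_cast k.succ_ne_zero
    have hT : hyp3F2Term a b 1 (e + 1) 1 k = hyp3F2Term a b 1 e 1 k * (e / (e + k)) := by
      simp only [hyp3F2Term]
      have h1 := ascPochhammer_eval_mul_add e k
      have h2 := ascPochhammer_eval_ne_zero he k
      have h3 := ascPochhammer_eval_ne_zero (by simpa using not_isNonposInt_add_natCast he 1) k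
      have h4 : (Nat.factorial k : ℂ) ≠ 0 := by exact_mod_cast k.factorial_ne_zero
      have h5 := ascPochhammer_eval_ne_zero (not_isNonposInt_of_re_pos (z := 1) (by simp)) k
      field_simp
      linear_combination ((ascPochhammer ℂ k).eval a) * (ascPochhammer ℂ k).eval b * h1
    rw [hT, hyp3F2Term_succ, add_comm (1 : ℂ)]
    push_cast
    field_simp
    ring

theorem tendsto_gauss (a b e : ℂ) :
    Tendsto (fun n : ℕ => ∑' k, hyp3F2Term a b 1 (e + n) 1 k) atTop (𝓝 1) := by
  have one : ∑' k : ℕ, (if k = 0 then (1 : ℂ) else 0) = 1 := tsum_ite_eq 0 _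
  rw [show 𝓝 (1 : ℂ) = 𝓝 (∑' k : ℕ, (if k = 0 then (1 : ℂ) else 0)) by rw [one]]
  set B : ℝ := ‖a‖ + ‖b‖ + 1 with hB
  have hB0 : 0 < B := by positivity
  refine tendsto_tsum_of_dominated_convergence
    (bound := fun k => ‖hyp3F2Term (‖a‖ : ℂ) (‖b‖ : ℂ) 1 (B : ℂ) 1 k‖) ?_ ?_ ?_
  · refine (summable_hyp3F2Term ?_).norm
    simp [hB]
    linarith
  · intro k
    induction k with
    | zero => simp [hyp3F2Term_zero]
    | succ k ih =>
      simp only [hyp3F2Term_succ]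
      have : Tendsto (fun n : ℕ => (a + k) * (b + k) * (1 + k) / ((e + n + k) * (1 + k) * (k + 1)))
          atTop (𝓝 0) := by
        have := (tendsto_inv_add_natCast (e + k)).const_mul
          ((a + k) * (b + k) * (1 + k) / ((1 + k) * (k + 1)))
        rw [mul_zero] at this
        refine this.congr fun n => ?_
        rw [show e + n + k = e + k + n by ring]
        simp only [div_eq_mul_inv, mul_inv]
        ring
      simpa using ih.mul this
  · obtain ⟨N, hN⟩ := exists_nat_ge (B - e.re)
    filter_upwards [eventually_ge_atTop N] with n hn k
    refine norm_hyp3F2Term_le_of_ratio_le (fun k => ?_) k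
    have hn' : (N : ℝ) ≤ n := by exact_mod_cast hn
    have h1 : ∀ z : ℂ, ‖z + k‖ ≤ ‖((‖z‖ : ℂ) + k)‖ := fun z => by
      have : ((‖z‖ : ℂ) + k) = ((‖z‖ + k : ℝ) : ℂ) := by push_cast; rfl
      rw [this, Complex.norm_real, Real.norm_of_nonneg (by positivity)]
      exact (norm_add_le _ _).trans (by simp)
    have h2 : ‖(B : ℂ) + k‖ ≤ ‖e + n + k‖ := by
      have : (B : ℂ) + k = ((B + k : ℝ) : ℂ) := by push_cast; rfl
      rw [this, Complex.norm_real, Real.norm_of_nonneg (by positivity)]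
      refine le_trans ?_ (Complex.re_le_norm _)
      simp
      linarith
    have h3 : 0 < ‖(B : ℂ) + k‖ := by
      have : (B : ℂ) + k = ((B + k : ℝ) : ℂ) := by push_cast; rfl
      rw [this, Complex.norm_real, Real.norm_of_nonneg (by positivity)]
      positivity
    have h4 : 0 < ‖(1 : ℂ) + k‖ := norm_pos_iff.2 (by rw [add_comm]; exact_mod_cast k.succ_ne_zero)
    have h5 : 0 < ‖(k : ℂ) + 1‖ := norm_pos_iff.2 (by exact_mod_cast k.succ_ne_zero)
    simp only [norm_div, norm_mul]
    gcongr
    · exact h1 a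
    · exact h1 b

/-- Gauss's evaluation of `₂F₁(a, b; e | 1)`. -/
theorem tsum_gauss {a b e : ℂ} (he : ¬ IsNonposInt e) (hs : 0 < (e - a - b).re) :
    ∑' k, hyp3F2Term a b 1 e 1 k =
      Gamma e * Gamma (e - a - b) / (Gamma (e - a) * Gamma (e - b)) := by
  have key := eq_mul_of_iterate (S := fun n : ℕ => ∑' k, hyp3F2Term a b 1 (e + n) 1 k)
    (r := fun n : ℕ => (e - a + n) * (e - b + n) / ((e + n) * (e - a - b + n)))
    (P := Gamma e * Gamma (e - a - b) / (Gamma (e - a) * Gamma (e - b))) (L := 1) ?_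
    (tendsto_gauss a b e) (tendsto_prod_ratio (by ring))
  · simpa using key
  · intro n
    have hs' : 0 < (e + n - a - b).re := by
      have : (0 : ℝ) ≤ n := n.cast_nonneg
      simp at hs ⊢
      linarith
    have h := gauss_recurrence (not_isNonposInt_add_natCast he n) hs'
    have h1 := add_natCast_ne_zero he n
    have h2 : e - a - b + n ≠ 0 := by
      intro h0
      rw [show e + n - a - b = e - a - b + n by ring, h0] at hs'
      simp at hs'
    have h3 : e + ((n + 1 : ℕ) : ℂ) = e + n + 1 := by push_cast; ring
    simp only [h3]
    rw [div_mul_eq_mul_div, eq_div_iff (mul_ne_zero h1 h2)]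
    linear_combination -h

/-! ### Watson's summation theorem -/

theorem hyp3F2Term_watson_shift (a b : ℂ) {c e : ℂ} (hc : c ≠ 0) (hf : ¬ IsNonposInt (2 * c))
    (k : ℕ) :
    hyp3F2Term a b (c + 1) e (2 * (c + 1)) k = hyp3F2Term a b c e (2 * c) k *
      (2 * (2 * c + 1) * (c + k) / ((2 * c + k) * (2 * c + (k + 1)))) := by
  simp only [hyp3F2Term]
  have hfk := add_natCast_ne_zero hf k
  have hfk1 : 2 * c + (k + 1) ≠ 0 := by simpa using add_natCast_ne_zero hf (k + 1)
  have h2c1 : 2 * c + 1 ≠ 0 := by simpa using add_natCast_ne_zero hf 1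
  have h1 := ascPochhammer_eval_mul_add c k
  have h2 := ascPochhammer_eval_mul_add (2 * c) k
  have h3 := ascPochhammer_eval_mul_add (2 * c + 1) k
  rw [show 2 * c + 1 + 1 = 2 * (c + 1) by ring] at h3
  have h5 := ascPochhammer_eval_ne_zero hf k
  have h8 : (ascPochhammer ℂ k).eval (c + 1) = (ascPochhammer ℂ k).eval c * (c + k) / c := by
    rw [h1]; field_simp
  have h9 : (ascPochhammer ℂ k).eval (2 * (c + 1)) =
      (ascPochhammer ℂ k).eval (2 * c) * (2 * c + k) * (2 * c + (k + 1)) /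
        (2 * c * (2 * c + 1)) := by
    rw [h2, eq_div_iff (by simp [hc, h2c1])]
    linear_combination -2 * c * h3
  rw [h8, h9]
  generalize (ascPochhammer ℂ k).eval c = C
  generalize (ascPochhammer ℂ k).eval (2 * c) = F at h5
  generalize (ascPochhammer ℂ k).eval e = E
  generalize (ascPochhammer ℂ k).eval a = A
  generalize (ascPochhammer ℂ k).eval b = B
  generalize (Nat.factorial k : ℂ) = N
  have hcc : c / c = 1 := div_self hc
  calc _ = A * B * C / (E * F * N) * (2 * (2 * c + 1) * (c + k) / ((2 * c + k) *
        (2 * c + (k + 1)))) * (c / c) := by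
        simp only [div_eq_mul_inv, mul_inv, inv_inv]
        ring
    _ = _ := by rw [hcc, mul_one]

/-- The telescoping relation between the Watson series at `c + 1` and at `c`. -/
theorem watson_recurrence {a b c e : ℂ} (h2e : 2 * e = a + b + 1) (he : ¬ IsNonposInt e)
    (hc : 0 < c.re) (hab : (a + b).re < 1) :
    (2 * c + 1 - a) * (2 * c + 1 - b) * ∑' k, hyp3F2Term a b (c + 1) e (2 * (c + 1)) k =
      (2 * c + 1) * (2 * c + 1 - a - b) * ∑' k, hyp3F2Term a b c e (2 * c) k := by
  have her : 2 * e.re = a.re + b.re + 1 := by simpa using congrArg re h2e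
  have hf : ¬ IsNonposInt (2 * c) := not_isNonposInt_of_re_pos (by simpa using hc)
  rw [add_re] at hab
  have hs0 : 0 < (e + 2 * c - a - b - c).re := by simp; linarith
  have hs1 : 0 < (e + 2 * (c + 1) - a - b - (c + 1)).re := by simp; linarith
  refine mul_tsum_eq_mul_tsum_of_telescoping
    (g := fun k => 2 * (2 * c + 1) * (1 + (e - 1 - 2 * c) * (2 * c + k)⁻¹) *
      (k * hyp3F2Term a b c e (2 * c) k))
    (summable_hyp3F2Term hs1) (summable_hyp3F2Term hs0) (by simp) ?_ fun k => ?_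
  · simpa using ((((tendsto_inv_add_natCast (2 * c)).const_mul (e - 1 - 2 * c)).const_add 1).const_mul
      (2 * (2 * c + 1))).mul (tendsto_nat_mul_hyp3F2Term hs0)
  · have hc0 : c ≠ 0 := by rintro rfl; simp at hc
    have h2c1 : 2 * c + 1 ≠ 0 := by simpa using add_natCast_ne_zero hf 1
    have hek := add_natCast_ne_zero he k
    have hfk := add_natCast_ne_zero hf k
    have hfk1 : 2 * c + (k + 1) ≠ 0 := by simpa using add_natCast_ne_zero hf (k + 1)
    have hk1 : (k : ℂ) + 1 ≠ 0 := by exact_mod_cast k.succ_ne_zero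
    have hT : hyp3F2Term a b (c + 1) e (2 * (c + 1)) k = hyp3F2Term a b c e (2 * c) k *
        (2 * (2 * c + 1) * (c + k) / ((2 * c + k) * (2 * c + (k + 1)))) := hyp3F2Term_watson_shift a b hc0 hf k
    rw [hT, hyp3F2Term_succ]
    push_cast
    obtain rfl : a = 2 * e - b - 1 := by linear_combination -h2e
    field_simp
    ring

theorem tendsto_watson {a b e c : ℂ} (h2e : 2 * e = a + b + 1) (hc : 0 < c.re)
    (hab : (a + b).re < 1) :
    Tendsto (fun n : ℕ => ∑' k, hyp3F2Term a b (c + n) e (2 * (c + n)) k) atTop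
      (𝓝 (∑' k, hyp3F2Term a b 1 e 1 k * (1 / 2) ^ k)) := by
  have her : 2 * e.re = a.re + b.re + 1 := by simpa using congrArg re h2e
  rw [add_re] at hab
  have hcn : ∀ n : ℕ, 0 < (c + n).re := fun n => by
    have : (0 : ℝ) ≤ n := n.cast_nonneg
    simp
    linarith
  refine tendsto_tsum_of_dominated_convergence
    (bound := fun k => ‖hyp3F2Term a b 1 e 1 k‖) ?_ ?_ ?_
  · refine (summable_hyp3F2Term ?_).norm
    simp
    linarith
  · intro k
    induction k with
    | zero => simp [hyp3F2Term_zero]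
    | succ k ih =>
      simp only [hyp3F2Term_succ]
      have hlim : Tendsto (fun n : ℕ => (c + n + k) / (2 * (c + n) + k)) atTop (𝓝 (1 / 2)) := by
        have h := ((tendsto_inv_add_natCast (c + k / 2)).const_mul ((k : ℂ) / 4)).const_add (1 / 2)
        rw [mul_zero, add_zero] at h
        refine h.congr fun n => ?_
        have hne : c + n + k / 2 ≠ 0 := by
          intro h0
          have h1 := congrArg re h0
          have h2 := hcn n
          have : (0 : ℝ) ≤ k := k.cast_nonneg
          simp at h1 h2
          linarith
        rw [show c + (k : ℂ) / 2 + n = c + n + k / 2 by ring,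
          show 2 * (c + n) + k = 2 * (c + n + k / 2) by ring,
          show c + n + (k : ℂ) = c + n + k / 2 + k / 2 by ring]
        generalize c + n + (k : ℂ) / 2 = w at hne
        field_simp
        ring
      have hk1 : (k : ℂ) + 1 ≠ 0 := by exact_mod_cast k.succ_ne_zero
      have hk2 : 1 + (k : ℂ) ≠ 0 := by rwa [add_comm]
      have h := (ih.mul_const ((a + k) * (b + k) / ((e + k) * (k + 1)))).mul hlim
      rw [pow_succ]
      convert h.congr fun n => ?_ using 2
      · field_simp
      · simp only [div_eq_mul_inv, mul_inv]
        ring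
  · refine Eventually.of_forall fun n k => ?_
    refine norm_hyp3F2Term_le_of_ratio_le (fun k => ?_) k
    have h1 : ‖c + n + k‖ ≤ ‖2 * (c + n) + k‖ := by
      have h2 := hcn n
      have hk : (0 : ℝ) ≤ k := k.cast_nonneg
      generalize c + n = z at h2
      rw [← sq_le_sq₀ (norm_nonneg _) (norm_nonneg _), Complex.sq_norm, Complex.sq_norm,
        Complex.normSq_apply, Complex.normSq_apply]
      simp
      nlinarith [mul_nonneg h2.le hk, sq_nonneg z.re, sq_nonneg z.im]
    have h3 : 0 < ‖2 * (c + n) + k‖ := by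
      refine lt_of_lt_of_le ?_ h1
      refine lt_of_lt_of_le ?_ (Complex.re_le_norm _)
      have h2 := hcn n
      have hk : (0 : ℝ) ≤ k := k.cast_nonneg
      rw [add_re, natCast_re]
      linarith
    have h4 : (1 : ℂ) + k ≠ 0 := by rw [add_comm]; exact_mod_cast k.succ_ne_zero
    have h5 : ‖(1 : ℂ) + k‖ ≠ 0 := norm_ne_zero_iff.2 h4
    simp only [norm_div, norm_mul]
    calc _ = ‖a + k‖ * ‖b + k‖ / (‖e + k‖ * ‖(k : ℂ) + 1‖) *
          (‖c + n + k‖ / ‖2 * (c + n) + k‖) := by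
            simp only [div_eq_mul_inv, mul_inv]; ring
      _ ≤ ‖a + k‖ * ‖b + k‖ / (‖e + k‖ * ‖(k : ℂ) + 1‖) * 1 := by
            gcongr
            exact div_le_one_of_le₀ h1 h3.le
      _ = _ := by
            rw [mul_one, show ‖a + k‖ * ‖b + k‖ * ‖(1 : ℂ) + k‖ / (‖e + k‖ * ‖(1 : ℂ) + k‖ *
              ‖(k : ℂ) + 1‖) = ‖a + k‖ * ‖b + k‖ / (‖e + k‖ * ‖(k : ℂ) + 1‖) *
              (‖(1 : ℂ) + k‖ / ‖(1 : ℂ) + k‖) by simp only [div_eq_mul_inv, mul_inv]; ring,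
              div_self h5, mul_one]

/-- The dependence of the Watson sum on `c`, up to its limit for `c → ∞`. -/
theorem tsum_watson_eq_mul_limit {a b c e : ℂ} (h2e : 2 * e = a + b + 1) (he : ¬ IsNonposInt e)
    (hc : 0 < c.re) (hab : (a + b).re < 1) :
    ∑' k, hyp3F2Term a b c e (2 * c) k =
      Gamma (c + 1 / 2) * Gamma (c + (1 - a - b) / 2) /
        (Gamma (c + (1 - a) / 2) * Gamma (c + (1 - b) / 2)) *
        ∑' k, hyp3F2Term a b 1 e 1 k * (1 / 2) ^ k := by
  have key := eq_mul_of_iterate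
    (S := fun n : ℕ => ∑' k, hyp3F2Term a b (c + n) e (2 * (c + n)) k)
    (r := fun n : ℕ => (c + (1 - a) / 2 + n) * (c + (1 - b) / 2 + n) /
      ((c + 1 / 2 + n) * (c + (1 - a - b) / 2 + n))) ?_
    (tendsto_watson h2e hc hab) (tendsto_prod_ratio (by ring))
  · simpa using key
  · intro n
    have hn : (0 : ℝ) ≤ n := n.cast_nonneg
    have hcn : 0 < (c + n).re := by simp; linarith
    have h := watson_recurrence h2e he hcn hab
    have h1 : c + 1 / 2 + n ≠ 0 := by
      intro h0
      have := congrArg re h0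
      simp at this
      linarith
    have h2 : c + (1 - a - b) / 2 + n ≠ 0 := by
      intro h0
      have := congrArg re h0
      simp at this hab
      linarith
    have h3 : c + ((n + 1 : ℕ) : ℂ) = c + n + 1 := by push_cast; ring
    simp only [h3]
    rw [div_mul_eq_mul_div, eq_div_iff (mul_ne_zero h1 h2)]
    linear_combination -h / 4

/-- For `c = 1` the Watson series is a shifted Gauss series, which gives the limit. -/
theorem watson_limit {a b e : ℂ} (h2e : 2 * e = a + b + 1) (he : ¬ IsNonposInt e)
    (ha : a.re < 0) (hb : b.re < 0) :
    ∑' k, hyp3F2Term a b 1 e 1 k * (1 / 2) ^ k =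
      (Real.sqrt Real.pi : ℂ) * Gamma e / (Gamma ((a + 1) / 2) * Gamma ((b + 1) / 2)) := by
  have hab : (a + b).re < 1 := by rw [add_re]; linarith
  have her : 2 * e.re = a.re + b.re + 1 := by simpa using congrArg re h2e
  have ha1 : a - 1 ≠ 0 := fun h => by have := congrArg re h; simp at this; linarith
  have hb1 : b - 1 ≠ 0 := fun h => by have := congrArg re h; simp at this; linarith
  have he1 : e - 1 ≠ 0 := fun h => by have := congrArg re h; simp at this; linarith
  have he' : ¬ IsNonposInt (e - 1) := by
    rintro ⟨k, hk⟩
    cases k with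
    | zero => exact he1 (by simpa using hk)
    | succ k => exact he ⟨k, by push_cast at hk; linear_combination hk⟩
  have hs : 0 < (e - 1 - (a - 1) - (b - 1)).re := by simp; linarith
  have hs' : 0 < (e - 1 + 1 - (a - 1) - (b - 1) - 1).re := by simp; linarith
  have gauss := tsum_gauss he' hs
  -- the series at `c = 1` is the Gauss series for `a - 1`, `b - 1`, `e - 1` without its first term
  have shift : ∑' k, hyp3F2Term (a - 1) (b - 1) 1 (e - 1) 1 k =
      1 + (a - 1) * (b - 1) / (e - 1) * ∑' k, hyp3F2Term a b 1 e (2 * 1) k := by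
    rw [(summable_hyp3F2Term hs').tsum_eq_zero_add, hyp3F2Term_zero, ← tsum_mul_left]
    congr 2
    ext k
    have q : ∀ z : ℂ, (ascPochhammer ℂ (k + 1)).eval (z - 1) =
        (z - 1) * (ascPochhammer ℂ k).eval z := fun z => by
      rw [ascPochhammer_succ_left]; simp
    have q1 : (ascPochhammer ℂ k).eval (1 : ℂ) = Nat.factorial k := by simp
    have q2 : (ascPochhammer ℂ k).eval (2 * 1 : ℂ) = Nat.factorial (k + 1) := by
      have := ascPochhammer_eval_mul_add 1 k
      rw [q1, show (1 : ℂ) + 1 = 2 * 1 by norm_num, one_mul] at this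
      rw [← this, Nat.factorial_succ]
      push_cast
      ring
    have q3 : (ascPochhammer ℂ (k + 1)).eval (1 : ℂ) = Nat.factorial (k + 1) := by simp
    simp only [hyp3F2Term]
    rw [q, q, q, q1, q2, q3]
    have f1 : (Nat.factorial k : ℂ) ≠ 0 := by exact_mod_cast k.factorial_ne_zero
    have f2 : (Nat.factorial (k + 1) : ℂ) ≠ 0 := by exact_mod_cast (k + 1).factorial_ne_zero
    have f3 := ascPochhammer_eval_ne_zero he k
    field_simp
  have W := tsum_watson_eq_mul_limit (c := 1) h2e he (by simp) hab
  rw [gauss, W] at shift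
  set L := ∑' k, hyp3F2Term a b 1 e 1 k * (1 / 2) ^ k with hL
  -- the reflection formula, used three times
  have r1 := Gamma_mul_Gamma_one_sub (e - 1)
  have r2 := Gamma_mul_Gamma_one_sub (e - a)
  have r3 := Gamma_mul_Gamma_one_sub ((a + 1) / 2)
  have r4 := Gamma_mul_Gamma_one_sub ((b + 1) / 2)
  rw [show 1 - (a + 1) / 2 = (1 - a) / 2 by ring] at r3
  rw [show 1 - (b + 1) / 2 = (1 - b) / 2 by ring] at r4
  have pos : ∀ z : ℂ, 0 < z.re → Gamma z ≠ 0 := fun z hz => Gamma_ne_zero_of_re_pos hz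
  have hA := pos ((1 - a) / 2) (by simp; linarith)
  have hB := pos ((1 - b) / 2) (by simp; linarith)
  have hE : Gamma (1 - (e - 1)) ≠ 0 := pos _ (by simp; linarith)
  have hE1 : Gamma (e - 1) ≠ 0 := Gamma_ne_zero fun m h => he' ⟨m, h⟩
  have gE : Gamma e = (e - 1) * Gamma (e - 1) := by
    simpa using Gamma_add_one (e - 1) he1
  have gA : Gamma (1 + (1 - a) / 2) = (1 - a) / 2 * Gamma ((1 - a) / 2) := by
    rw [add_comm, Gamma_add_one]
    intro h; apply ha1; linear_combination -2 * h
  have gB : Gamma (1 + (1 - b) / 2) = (1 - b) / 2 * Gamma ((1 - b) / 2) := by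
    rw [add_comm, Gamma_add_one]
    intro h; apply hb1; linear_combination -2 * h
  have gH : Gamma (1 + 1 / 2) = (Real.sqrt Real.pi : ℂ) / 2 := by
    rw [add_comm, Gamma_add_one _ (by norm_num), Gamma_one_half_eq, Real.sqrt_eq_rpow]
    push_cast [Complex.ofReal_cpow Real.pi_pos.le]
    ring
  have hpi : (Real.pi : ℂ) ≠ 0 := by exact_mod_cast Real.pi_ne_zero
  have hsq : (Real.sqrt Real.pi : ℂ) ^ 2 = Real.pi := by
    exact_mod_cast Real.sq_sqrt Real.pi_pos.le
  have hsq0 : (Real.sqrt Real.pi : ℂ) ≠ 0 := by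
    intro h; rw [h] at hsq; simp at hsq; exact hpi hsq.symm
  have hsin : sin (Real.pi * (e - 1)) ≠ 0 := by
    intro h
    rw [h, div_zero] at r1
    exact mul_ne_zero hE1 hE r1
  have trig : 2 * sin (Real.pi * ((a + 1) / 2)) * sin (Real.pi * ((b + 1) / 2)) =
      sin (Real.pi * (e - a)) - sin (Real.pi * (e - 1)) := by
    set α := (Real.pi : ℂ) * ((a + 1) / 2) with hα
    set β := (Real.pi : ℂ) * ((b + 1) / 2) with hβ
    have e1 : (Real.pi : ℂ) * (e - a) = Real.pi / 2 - (α - β) := by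
      rw [hα, hβ]; linear_combination (Real.pi / 2 : ℂ) * h2e
    have e2 : (Real.pi : ℂ) * (e - 1) = Real.pi / 2 - (2 * Real.pi - (α + β)) := by
      rw [hα, hβ]; linear_combination (Real.pi / 2 : ℂ) * h2e
    rw [e1, e2, sin_pi_div_two_sub, sin_pi_div_two_sub, cos_two_pi_sub, cos_sub, cos_add]
    ring
  have G1 : Gamma (e - 1) * Gamma (1 - (e - 1)) / (Gamma (e - a) * Gamma (1 - (e - a))) =
      sin (Real.pi * (e - a)) / sin (Real.pi * (e - 1)) := by
    rw [r1, r2, div_div_div_cancel_left' _ _ hpi]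
  rw [show e - 1 - (a - 1) - (b - 1) = 1 - (e - 1) by linear_combination h2e,
    show e - 1 - (a - 1) = e - a by ring, show e - 1 - (b - 1) = 1 - (e - a) by
      linear_combination h2e, G1, show 1 + (1 - a - b) / 2 = 1 - (e - 1) by
      linear_combination h2e / 2, gA, gB, gH] at shift
  have G3 : (Gamma ((a + 1) / 2))⁻¹ = Gamma ((1 - a) / 2) * sin (Real.pi * ((a + 1) / 2)) /
      Real.pi := by
    rw [mul_div_assoc, ← inv_div (Real.pi : ℂ), ← r3, mul_inv, mul_left_comm, mul_inv_cancel₀ hA, mul_one]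
  have G4 : (Gamma ((b + 1) / 2))⁻¹ = Gamma ((1 - b) / 2) * sin (Real.pi * ((b + 1) / 2)) /
      Real.pi := by
    rw [mul_div_assoc, ← inv_div (Real.pi : ℂ), ← r4, mul_inv, mul_left_comm, mul_inv_cancel₀ hB, mul_one]
  rw [div_eq_mul_inv, mul_inv, G3, G4, gE]
  rw [eq_div_iff hsin] at r1
  clear_value L
  clear gauss W gE gA gB gH G1 G3 G4 r2 r3 r4 hL pos
  generalize Gamma ((1 - a) / 2) = A at *
  generalize Gamma ((1 - b) / 2) = B at *
  generalize Gamma (1 - (e - 1)) = G at *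
  generalize Gamma (e - 1) = E at *
  generalize sin (Real.pi * (e - 1)) = s at *
  generalize sin (Real.pi * (e - a)) = s' at *
  generalize sin (Real.pi * ((a + 1) / 2)) = x at *
  generalize sin (Real.pi * ((b + 1) / 2)) = y at *
  generalize (Real.sqrt Real.pi : ℂ) = q at *
  generalize (Real.pi : ℂ) = p at *
  have ha2 : 1 - a ≠ 0 := fun h => ha1 (by linear_combination -h)
  have hb2 : 1 - b ≠ 0 := fun h => hb1 (by linear_combination -h)
  have hx : (a - 1) * (b - 1) / (e - 1) * (q / 2 * G / ((1 - a) / 2 * A * ((1 - b) / 2 * B)) * L) =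
      2 * q * G * L / ((e - 1) * A * B) := by
    rw [show (a - 1) * (b - 1) = (1 - a) * (1 - b) by ring]
    field_simp
  rw [hx] at shift
  have hz : q * G * L * s = x * y * ((e - 1) * A * B) := by
    field_simp at shift
    linear_combination (-1 / 2 : ℂ) * shift - (1 / 2 : ℂ) * (e - 1) * A * B * trig
  have hL : L = x * y * ((e - 1) * A * B) / (q * G * s) := by
    rw [eq_div_iff (by simp [hsq0, hE, hsin])]
    linear_combination hz
  have hE' : E = p / (G * s) := by
    rw [eq_div_iff (by simp [hE, hsin])]
    linear_combination r1
  subst hsq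
  rw [hL, hE']
  field_simp

/-- Closed form of the Watson series `W_{0,0}`. -/
noncomputable def watsonZeroZero (a b c : ℂ) : ℂ :=
  (Real.sqrt Real.pi : ℂ) * Gamma (c + 1 / 2) * Gamma (a / 2 + b / 2 + 1 / 2) *
      Gamma (c - a / 2 - b / 2 + 1 / 2) *
    ((Gamma (a / 2 + 1 / 2))⁻¹ * (Gamma (b / 2 + 1 / 2))⁻¹ * (Gamma (c - a / 2 + 1 / 2))⁻¹ *
      (Gamma (c - b / 2 + 1 / 2))⁻¹)

theorem tsum_watson {a b c e : ℂ} (h2e : 2 * e = a + b + 1) (he : ¬ IsNonposInt e)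
    (ha : a.re < 0) (hb : b.re < 0) (hc : 0 < c.re) :
    ∑' k, hyp3F2Term a b c e (2 * c) k = watsonZeroZero a b c := by
  rw [tsum_watson_eq_mul_limit h2e he hc (by rw [add_re]; linarith), watson_limit h2e he ha hb,
    watsonZeroZero, show e = a / 2 + b / 2 + 1 / 2 by linear_combination h2e / 2,
    show c + (1 - a - b) / 2 = c - a / 2 - b / 2 + 1 / 2 by ring,
    show c + (1 - a) / 2 = c - a / 2 + 1 / 2 by ring,
    show c + (1 - b) / 2 = c - b / 2 + 1 / 2 by ring, add_div a 1 2, add_div b 1 2]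
  generalize Gamma _ = x1
  simp only [div_eq_mul_inv _ (_ * _), mul_inv]
  ring

/-! ### Contiguous relations -/

theorem ascPochhammer_succ_eval_left (z : ℂ) (k : ℕ) :
    (ascPochhammer ℂ (k + 1)).eval z = z * (ascPochhammer ℂ k).eval (z + 1) := by
  rw [ascPochhammer_succ_left]
  simp

theorem not_isNonposInt_add_one {z : ℂ} (hz : ¬ IsNonposInt z) : ¬ IsNonposInt (z + 1) := by
  simpa using not_isNonposInt_add_natCast hz 1

theorem ne_zero_of_not_isNonposInt {z : ℂ} (hz : ¬ IsNonposInt z) : z ≠ 0 := by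
  simpa using add_natCast_ne_zero hz 0

theorem tsum_sub_tsum_eq_mul_tsum_of_shift {u v w : ℕ → ℂ} {C : ℂ} (hu : Summable u)
    (hv : Summable v) (h0 : u 0 = v 0) (h : ∀ k, u (k + 1) - v (k + 1) = C * w k) :
    ∑' k, u k - ∑' k, v k = C * ∑' k, w k := by
  rw [← hu.tsum_sub hv, (hu.sub hv).tsum_eq_zero_add, h0, sub_self, zero_add, ← tsum_mul_left]
  exact tsum_congr h

/-- Raising the second lower parameter from `2 c` to `2 c + 1`. -/
theorem tsum_hyp3F2_lower_add_one {a b c e : ℂ} (he : ¬ IsNonposInt e) (hc : ¬ IsNonposInt (2 * c))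
    (hs : 0 < (e + 2 * c - a - b - c).re) :
    ∑' k, hyp3F2Term a b c e (2 * c) k - ∑' k, hyp3F2Term a b c e (2 * c + 1) k =
      a * b / (2 * e * (2 * c + 1)) *
        ∑' k, hyp3F2Term (a + 1) (b + 1) (c + 1) (e + 1) (2 * (c + 1)) k := by
  refine tsum_sub_tsum_eq_mul_tsum_of_shift (summable_hyp3F2Term hs)
    (summable_hyp3F2Term (by simp at hs ⊢; linarith))
    (by rw [hyp3F2Term_zero, hyp3F2Term_zero]) fun k => ?_
  have hc1 := not_isNonposInt_add_one hc
  have h1 := ascPochhammer_eval_mul_add (2 * c + 1) k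
  rw [show 2 * c + 1 + 1 = 2 * (c + 1) by ring] at h1
  have n1 := ascPochhammer_eval_ne_zero (not_isNonposInt_add_one he) k
  have n2 := ascPochhammer_eval_ne_zero hc1 k
  have n3 : 2 * c + 1 + k ≠ 0 := add_natCast_ne_zero hc1 k
  have n4 := ne_zero_of_not_isNonposInt he
  have n5 := ne_zero_of_not_isNonposInt hc
  have n6 := ne_zero_of_not_isNonposInt hc1
  have n7 : (Nat.factorial k : ℂ) ≠ 0 := by exact_mod_cast k.factorial_ne_zero
  have n8 : (k : ℂ) + 1 ≠ 0 := by exact_mod_cast k.succ_ne_zero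
  have n9 : c ≠ 0 := fun h => n5 (by rw [h, mul_zero])
  have h2 : (ascPochhammer ℂ k).eval (2 * (c + 1)) =
      (ascPochhammer ℂ k).eval (2 * c + 1) * (2 * c + 1 + k) / (2 * c + 1) := by
    rw [h1]; field_simp
  simp only [hyp3F2Term, ascPochhammer_succ_eval_left, Nat.factorial_succ,
    show 2 * c + 1 + 1 = 2 * (c + 1) by ring]
  rw [h2]
  push_cast
  generalize (ascPochhammer ℂ k).eval (e + 1) = E at n1
  generalize (ascPochhammer ℂ k).eval (2 * c + 1) = F at n2
  generalize (ascPochhammer ℂ k).eval (a + 1) = A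
  generalize (ascPochhammer ℂ k).eval (b + 1) = B
  generalize (ascPochhammer ℂ k).eval (c + 1) = C
  generalize (Nat.factorial k : ℂ) = N at n7
  generalize (k : ℂ) = x at n3 n8 ⊢
  obtain ⟨y, rfl⟩ : ∃ y, x = y - (2 * c + 1) := ⟨2 * c + 1 + x, by ring⟩
  rw [add_sub_cancel] at n3 ⊢
  rw [mul_comm 2 c] at n6 n8 ⊢
  field_simp
  ring

/-- Lowering the second lower parameter from `2 c` to `2 c - 1`, written with `c = d + 1`. -/
theorem tsum_hyp3F2_lower_sub_one {a b d e : ℂ} (he : ¬ IsNonposInt e) (hd : ¬ IsNonposInt (2 * d))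
    (hs : 0 < (e + 2 * d - a - b - d).re) :
    ∑' k, hyp3F2Term a b (d + 1) e (2 * d + 1) k - ∑' k, hyp3F2Term a b d e (2 * d) k =
      a * b / (2 * e * (2 * d + 1)) *
        ∑' k, hyp3F2Term (a + 1) (b + 1) (d + 1) (e + 1) (2 * (d + 1)) k := by
  refine tsum_sub_tsum_eq_mul_tsum_of_shift
    (summable_hyp3F2Term (by simp at hs ⊢; linarith)) (summable_hyp3F2Term hs)
    (by rw [hyp3F2Term_zero, hyp3F2Term_zero]) fun k => ?_
  have hd1 := not_isNonposInt_add_one hd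
  have h1 := ascPochhammer_eval_mul_add (2 * d + 1) k
  rw [show 2 * d + 1 + 1 = 2 * (d + 1) by ring] at h1
  have n1 := ascPochhammer_eval_ne_zero (not_isNonposInt_add_one he) k
  have n2 := ascPochhammer_eval_ne_zero hd1 k
  have n3 : 2 * d + 1 + k ≠ 0 := add_natCast_ne_zero hd1 k
  have n4 := ne_zero_of_not_isNonposInt he
  have n5 := ne_zero_of_not_isNonposInt hd
  have n6 := ne_zero_of_not_isNonposInt hd1
  have n7 : (Nat.factorial k : ℂ) ≠ 0 := by exact_mod_cast k.factorial_ne_zero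
  have n8 : (k : ℂ) + 1 ≠ 0 := by exact_mod_cast k.succ_ne_zero
  have n9 : d ≠ 0 := fun h => n5 (by rw [h, mul_zero])
  have h2 : (ascPochhammer ℂ k).eval (2 * (d + 1)) =
      (ascPochhammer ℂ k).eval (2 * d + 1) * (2 * d + 1 + k) / (2 * d + 1) := by
    rw [h1]; field_simp
  have h3 : (ascPochhammer ℂ (k + 1)).eval (d + 1) =
      (ascPochhammer ℂ k).eval (d + 1) * (d + 1 + k) := ascPochhammer_succ_eval _ _
  simp only [hyp3F2Term]
  rw [h3]
  simp only [ascPochhammer_succ_eval_left, Nat.factorial_succ,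
    show 2 * d + 1 + 1 = 2 * (d + 1) by ring]
  rw [h2]
  push_cast
  generalize (ascPochhammer ℂ k).eval (e + 1) = E at n1
  generalize (ascPochhammer ℂ k).eval (2 * d + 1) = F at n2
  generalize (ascPochhammer ℂ k).eval (a + 1) = A
  generalize (ascPochhammer ℂ k).eval (b + 1) = B
  generalize (ascPochhammer ℂ k).eval (d + 1) = C
  generalize (Nat.factorial k : ℂ) = N at n7
  generalize (k : ℂ) = x at n3 n8 ⊢
  obtain ⟨y, rfl⟩ : ∃ y, x = y - (2 * d + 1) := ⟨2 * d + 1 + x, by ring⟩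
  rw [add_sub_cancel] at n3 ⊢
  rw [mul_comm 2 d] at n6 n8 ⊢
  field_simp
  ring

/-- Reduces `(b - a) W_{1,n}` to `W_{0,n}`: raising `a` or `b` by `1` with the lower parameters fixed
turns `m = 1` into `m = 0`. -/
theorem tsum_hyp3F2_upper_sub {a b c e f : ℂ} (hs : 0 < (e + f - a - b - c).re - 1) :
    (b - a) * ∑' k, hyp3F2Term a b c e f k =
      b * ∑' k, hyp3F2Term a (b + 1) c e f k - a * ∑' k, hyp3F2Term (a + 1) b c e f k := by
  have s1 : 0 < (e + f - a - (b + 1) - c).re := by simp at hs ⊢; linarith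
  have s2 : 0 < (e + f - (a + 1) - b - c).re := by simp at hs ⊢; linarith
  rw [← tsum_mul_left, ← tsum_mul_left, ← tsum_mul_left,
    ← ((summable_hyp3F2Term s1).mul_left b).tsum_sub ((summable_hyp3F2Term s2).mul_left a)]
  refine tsum_congr fun k => ?_
  have h1 := ascPochhammer_eval_mul_add a k
  have h2 := ascPochhammer_eval_mul_add b k
  simp only [hyp3F2Term, div_eq_mul_inv]
  generalize ((ascPochhammer ℂ k).eval e * _ * _)⁻¹ = D
  linear_combination (ascPochhammer ℂ k).eval a * (ascPochhammer ℂ k).eval c * D * h2 -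
    (ascPochhammer ℂ k).eval b * (ascPochhammer ℂ k).eval c * D * h1

/-- Reduces `(a + b) W_{-1,n}` to `W_{0,n}`, because `e = (a + b) / 2`. -/
theorem tsum_hyp3F2_upper_add {a b c e f : ℂ} (h2e : 2 * e = a + b) (he : ¬ IsNonposInt e)
    (hs : 0 < (e + f - a - b - c).re) :
    (a + b) * ∑' k, hyp3F2Term a b c e f k =
      a * ∑' k, hyp3F2Term (a + 1) b c (e + 1) f k +
        b * ∑' k, hyp3F2Term a (b + 1) c (e + 1) f k := by
  have s1 : 0 < (e + 1 + f - a - (b + 1) - c).re := by simp at hs ⊢; linarith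
  have s2 : 0 < (e + 1 + f - (a + 1) - b - c).re := by simp at hs ⊢; linarith
  rw [← tsum_mul_left, ← tsum_mul_left, ← tsum_mul_left,
    ← ((summable_hyp3F2Term s2).mul_left a).tsum_add ((summable_hyp3F2Term s1).mul_left b)]
  refine tsum_congr fun k => ?_
  have h1 := ascPochhammer_eval_mul_add a k
  have h2 := ascPochhammer_eval_mul_add b k
  have h3 := ascPochhammer_eval_mul_add e k
  have n1 := ascPochhammer_eval_ne_zero he k
  have n2 := ne_zero_of_not_isNonposInt he
  have n3 := ascPochhammer_eval_ne_zero (not_isNonposInt_add_one he) k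
  have h4 : ((ascPochhammer ℂ k).eval e)⁻¹ * e =
      ((ascPochhammer ℂ k).eval (e + 1))⁻¹ * (e + k) := by
    field_simp
    linear_combination -h3
  simp only [hyp3F2Term, div_eq_mul_inv, mul_inv]
  generalize ((ascPochhammer ℂ k).eval e)⁻¹ = D at *
  generalize ((ascPochhammer ℂ k).eval (e + 1))⁻¹ = D' at *
  generalize ((ascPochhammer ℂ k).eval f)⁻¹ = F
  generalize ((Nat.factorial k : ℂ))⁻¹ = N
  linear_combination 2 * (ascPochhammer ℂ k).eval a * (ascPochhammer ℂ k).eval b *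
      (ascPochhammer ℂ k).eval c * F * N * h4 +
    (ascPochhammer ℂ k).eval b * (ascPochhammer ℂ k).eval c * D' * F * N * h1 +
    (ascPochhammer ℂ k).eval a * (ascPochhammer ℂ k).eval c * D' * F * N * h2 -
    (ascPochhammer ℂ k).eval a * (ascPochhammer ℂ k).eval b * (ascPochhammer ℂ k).eval c * F * N *
      (D - D') * h2e

/-! ### The closed forms far from the boundary of convergence -/

theorem inv_Gamma_eq_mul {z w : ℂ} (h : w = z + 1) : (Gamma z)⁻¹ = z * (Gamma w)⁻¹ := by
  rw [h, one_div_Gamma_eq_self_mul_one_div_Gamma_add_one]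

theorem Gamma_eq_mul {z w : ℂ} (h : w = z + 1) (hz : z ≠ 0) : Gamma w = z * Gamma z := by
  rw [h, Gamma_add_one z hz]

theorem Gamma_ne_zero_of_not_isNonposInt {z : ℂ} (hz : ¬ IsNonposInt z) : Gamma z ≠ 0 :=
  Gamma_ne_zero fun m h => hz ⟨m, h⟩

theorem tsum_watson_zero_negOne {a b c e : ℂ} (h2e : 2 * e = a + b + 1) (he : ¬ IsNonposInt e)
    (ha : a.re < -1) (hb : b.re < -1) (hc : 1 < c.re) :
    ∑' k, hyp3F2Term a b c e (2 * c - 1) k = watsonZeroNegOne a b c := by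
  have her : 2 * e.re = a.re + b.re + 1 := by simpa using congrArg re h2e
  have hd : 0 < (c - 1).re := by simpa using hc
  have h := tsum_hyp3F2_lower_sub_one (a := a) (b := b) (d := c - 1) he
    (not_isNonposInt_of_re_pos (by simpa using hd)) (by simp; linarith)
  rw [sub_add_cancel, show 2 * (c - 1) + 1 = 2 * c - 1 by ring,
    tsum_watson h2e he (by linarith) (by linarith) hd,
    tsum_watson (by linear_combination h2e) (not_isNonposInt_add_one he) (by simp; linarith)
      (by simp; linarith) (by linarith), sub_eq_iff_eq_add] at h
  have he0 := ne_zero_of_not_isNonposInt he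
  obtain rfl : e = a / 2 + b / 2 + 1 / 2 := by linear_combination h2e / 2
  have hc1 : c - 1 / 2 ≠ 0 := Complex.ne_zero_of_re_pos (by simp; linarith)
  have hc2 : 2 * c - 1 ≠ 0 := fun h => hc1 (by linear_combination h / 2)
  have g1 := Gamma_eq_mul (z := c - 1 / 2) (w := c + 1 / 2) (by ring) hc1
  have g2 := Gamma_eq_mul (z := a / 2 + b / 2 + 1 / 2) (w := (a + 1) / 2 + (b + 1) / 2 + 1 / 2)
    (by ring) he0
  have g3 := inv_Gamma_eq_mul (z := a / 2) (w := (a + 1) / 2 + 1 / 2) (by ring)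
  have g4 := inv_Gamma_eq_mul (z := b / 2) (w := (b + 1) / 2 + 1 / 2) (by ring)
  rw [h, watsonZeroZero, watsonZeroZero, watsonZeroNegOne, g1, g2,
    show c - 1 + 1 / 2 = c - 1 / 2 by ring,
    show c - 1 - a / 2 - b / 2 + 1 / 2 = c - a / 2 - b / 2 - 1 / 2 by ring,
    show c - (a + 1) / 2 - (b + 1) / 2 + 1 / 2 = c - a / 2 - b / 2 - 1 / 2 by ring,
    show c - 1 - a / 2 + 1 / 2 = c - 1 / 2 - a / 2 by ring,
    show c - 1 - b / 2 + 1 / 2 = c - 1 / 2 - b / 2 by ring,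
    show c - (a + 1) / 2 + 1 / 2 = c - a / 2 by ring,
    show c - (b + 1) / 2 + 1 / 2 = c - b / 2 by ring, one_div (_ * _), one_div (_ * _)]
  simp only [mul_inv]
  rw [g3, g4]
  have hx : a * b / (2 * (a / 2 + b / 2 + 1 / 2) * (2 * c - 1)) * (c - 1 / 2) *
      (a / 2 + b / 2 + 1 / 2) = a / 2 * (b / 2) := by
    rw [show 2 * c - 1 = 2 * (c - 1 / 2) by ring]
    generalize a / 2 + b / 2 + 1 / 2 = w at he0
    generalize c - 1 / 2 = z at hc1
    field_simp
  linear_combination (Real.sqrt Real.pi : ℂ) * Gamma (c - 1 / 2) * Gamma (a / 2 + b / 2 + 1 / 2) *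
    Gamma (c - a / 2 - b / 2 - 1 / 2) * (Gamma ((a + 1) / 2 + 1 / 2))⁻¹ *
    (Gamma ((b + 1) / 2 + 1 / 2))⁻¹ * (Gamma (c - a / 2))⁻¹ * (Gamma (c - b / 2))⁻¹ * hx

/-- Closed form of `W_{0,1}`. -/
noncomputable def watsonZeroOne (a b c : ℂ) : ℂ :=
  (Real.sqrt Real.pi : ℂ) * Gamma (c + 1 / 2) * Gamma (a / 2 + b / 2 + 1 / 2) *
      Gamma (c - a / 2 - b / 2 + 1 / 2) *
    ((Gamma (a / 2 + 1 / 2))⁻¹ * (Gamma (b / 2 + 1 / 2))⁻¹ * (Gamma (c - a / 2 + 1 / 2))⁻¹ *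
        (Gamma (c - b / 2 + 1 / 2))⁻¹ -
      (Gamma (a / 2))⁻¹ * (Gamma (b / 2))⁻¹ * (Gamma (c - a / 2 + 1))⁻¹ *
        (Gamma (c - b / 2 + 1))⁻¹)

theorem tsum_watson_zero_one {a b c e : ℂ} (h2e : 2 * e = a + b + 1) (he : ¬ IsNonposInt e)
    (ha : a.re < -1) (hb : b.re < -1) (hc : 0 < c.re) :
    ∑' k, hyp3F2Term a b c e (2 * c + 1) k = watsonZeroOne a b c := by
  have her : 2 * e.re = a.re + b.re + 1 := by simpa using congrArg re h2e
  have h := tsum_hyp3F2_lower_add_one (a := a) (b := b) (c := c) he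
    (not_isNonposInt_of_re_pos (by simpa using hc)) (by simp; linarith)
  rw [tsum_watson h2e he (by linarith) (by linarith) hc,
    tsum_watson (by linear_combination h2e) (not_isNonposInt_add_one he) (by simp; linarith)
      (by simp; linarith) (by simp; linarith), sub_eq_iff_eq_add, ← sub_eq_iff_eq_add'] at h
  have he0 := ne_zero_of_not_isNonposInt he
  obtain rfl : e = a / 2 + b / 2 + 1 / 2 := by linear_combination h2e / 2
  have hc1 : c + 1 / 2 ≠ 0 := Complex.ne_zero_of_re_pos (by simp; linarith)
  have g1 := Gamma_eq_mul (z := c + 1 / 2) (w := c + 1 + 1 / 2) (by ring) hc1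
  have g2 := Gamma_eq_mul (z := a / 2 + b / 2 + 1 / 2) (w := (a + 1) / 2 + (b + 1) / 2 + 1 / 2)
    (by ring) he0
  have g3 := inv_Gamma_eq_mul (z := a / 2) (w := (a + 1) / 2 + 1 / 2) (by ring)
  have g4 := inv_Gamma_eq_mul (z := b / 2) (w := (b + 1) / 2 + 1 / 2) (by ring)
  rw [← h, watsonZeroZero, watsonZeroZero, watsonZeroOne, g1, g2, g3, g4,
    show c + 1 - (a + 1) / 2 - (b + 1) / 2 + 1 / 2 = c - a / 2 - b / 2 + 1 / 2 by ring,
    show c + 1 - (a + 1) / 2 + 1 / 2 = c - a / 2 + 1 by ring,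
    show c + 1 - (b + 1) / 2 + 1 / 2 = c - b / 2 + 1 by ring]
  have hx : a * b / (2 * (a / 2 + b / 2 + 1 / 2) * (2 * c + 1)) * (c + 1 / 2) *
      (a / 2 + b / 2 + 1 / 2) = a / 2 * (b / 2) := by
    rw [show 2 * c + 1 = 2 * (c + 1 / 2) by ring]
    generalize a / 2 + b / 2 + 1 / 2 = w at he0
    generalize c + 1 / 2 = z at hc1
    field_simp
  linear_combination -(Real.sqrt Real.pi : ℂ) * Gamma (c + 1 / 2) * Gamma (a / 2 + b / 2 + 1 / 2) *
    Gamma (c - a / 2 - b / 2 + 1 / 2) * (Gamma ((a + 1) / 2 + 1 / 2))⁻¹ *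
    (Gamma ((b + 1) / 2 + 1 / 2))⁻¹ * (Gamma (c - a / 2 + 1))⁻¹ * (Gamma (c - b / 2 + 1))⁻¹ * hx

/-- Simplification of a gamma quotient in the closed form of `W_{-1,1}`. Each variable stands for a
gamma value or a power of `2`, `q` for `√π`, and `h₁`, `h₂` are instances of the duplication
formula. -/
theorem gamma_quotient_negOne_one {A A' G M N R T P Q q : ℂ} (hA' : A' ≠ 0) (hG : G ≠ 0) (hN : N ≠ 0)
    (hT : T ≠ 0) (h₁ : A * A' = G * P * q) (h₂ : R * N = M * Q * q) (hP : P = T * Q) :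
    A * G⁻¹ * (M * N⁻¹) * T⁻¹ = R * A'⁻¹ := by
  field_simp
  linear_combination M * h₁ - T * G * h₂ + G * q * M * hP

/-- Simplification of a gamma quotient in the closed form of `W_{1,0}`, by three instances of the
duplication formula. -/
theorem gamma_quotient_one_zero {A A' C C' G M N R Z P₁ P₂ P₃ q : ℂ} (hA' : A' ≠ 0) (hC' : C' ≠ 0)
    (hG : G ≠ 0) (hN : N ≠ 0) (hZ : Z ≠ 0) (h₁ : A * A' = G * P₁ * q) (h₂ : N * R = M * P₂ * q)
    (h₃ : C * C' = Z * P₃ * q) (hP : P₁ * P₃ = 2 * P₂) :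
    C * A * M * (Z⁻¹ * N⁻¹ * G⁻¹) = 2 * q * R * A'⁻¹ * C'⁻¹ := by
  field_simp
  linear_combination M * C * C' * h₁ + M * G * P₁ * q * h₃ + G * Z * q ^ 2 * M * hP -
    2 * q * G * Z * h₂

/-- Simplification of a gamma quotient in the closed form of `W_{1,-1}`, by two instances of the
duplication formula. -/
theorem gamma_quotient_one_negOne {A A' V V' G Z T P₁ P₂ q : ℂ} (hA : A ≠ 0) (hV : V ≠ 0)
    (hG : G ≠ 0) (hZ : Z ≠ 0) (hq : q ≠ 0) (h₁ : A * A' = G * P₁ * q) (h₂ : V * V' = Z * P₂ * q)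
    (hP : P₁ * P₂ * T = 1) : A' * V' * T * (q⁻¹ * G⁻¹ * Z⁻¹) = q * A⁻¹ * V⁻¹ := by
  field_simp
  linear_combination T * V * V' * h₁ + T * G * P₁ * q * h₂ + G * q ^ 2 * Z * hP

theorem tsum_watson_negOne_one {a b c e : ℂ} (h2e : 2 * e = a + b) (he : ¬ IsNonposInt e)
    (ha0 : ¬ IsNonposInt a) (ha : a.re < -2) (hb : b.re < -2) (hc : 0 < c.re) :
    ∑' k, hyp3F2Term a b c e (2 * c + 1) k = watsonNegOneOne a b c := by
  have her : 2 * e.re = a.re + b.re := by simpa using congrArg re h2e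
  have h := tsum_hyp3F2_upper_add (c := c) (f := 2 * c + 1) h2e he (by simp; linarith)
  rw [tsum_watson_zero_one (by linear_combination h2e) (not_isNonposInt_add_one he)
      (by simp; linarith) (by linarith) hc,
    tsum_watson_zero_one (by linear_combination h2e) (not_isNonposInt_add_one he)
      (by linarith) (by simp; linarith) hc] at h
  have he0 := ne_zero_of_not_isNonposInt he
  obtain rfl : e = a / 2 + b / 2 := by linear_combination h2e / 2
  have hab0 : a + b ≠ 0 := fun h => he0 (by linear_combination h / 2)
  have hs : c - a / 2 - b / 2 ≠ 0 := Complex.ne_zero_of_re_pos (by simp; linarith)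
  have g1 := Gamma_eq_mul (z := a / 2 + b / 2) (w := a / 2 + b / 2 + 1) rfl he0
  have g2 := Gamma_eq_mul (z := c - a / 2 - b / 2) (w := 1 + c - a / 2 - b / 2) (by ring) hs
  have g3 := inv_Gamma_eq_mul (z := a / 2) (w := a / 2 + 1) rfl
  have g4 := inv_Gamma_eq_mul (z := b / 2) (w := b / 2 + 1) rfl
  have g5 := inv_Gamma_eq_mul (z := c - a / 2) (w := c - a / 2 + 1) rfl
  have g6 := inv_Gamma_eq_mul (z := c - b / 2) (w := 1 + c - b / 2) (by ring)
  have d1 := Gamma_mul_Gamma_add_half (a / 2)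
  have d2 := Gamma_mul_Gamma_add_half (c + 1 / 2)
  rw [mul_div_cancel₀ a two_ne_zero] at d1
  rw [show c + 1 / 2 + 1 / 2 = c + 1 by ring, show 2 * (c + 1 / 2) = 1 + 2 * c by ring,
    show 1 - (1 + 2 * c) = -(2 * c) by ring] at d2
  have hp : (2 : ℂ) ^ (1 - a) = (2 : ℂ) ^ (1 + 2 * c - a) * (2 : ℂ) ^ (-(2 * c)) := by
    rw [← cpow_add _ _ two_ne_zero]
    congr 1
    ring
  have hT : (2 : ℂ) ^ (1 + 2 * c - a) ≠ 0 := by simp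
  have hP : (2 : ℂ) ^ (1 - a) ≠ 0 := by simp
  have hq : (Real.sqrt Real.pi : ℂ) ≠ 0 := by
    exact_mod_cast (Real.sqrt_pos.2 Real.pi_pos).ne'
  have hGa := Gamma_ne_zero_of_not_isNonposInt ha0
  have hN : Gamma (c + 1) ≠ 0 := Gamma_ne_zero_of_re_pos (by simp; linarith)
  have hAA : Gamma (a / 2) * Gamma (a / 2 + 1 / 2) ≠ 0 := by
    rw [d1]
    exact mul_ne_zero (mul_ne_zero hGa hP) hq
  have hA := left_ne_zero_of_mul hAA
  have hA' := right_ne_zero_of_mul hAA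
  have k1 : Gamma (a / 2) * (Gamma a)⁻¹ * (Gamma (1 + 2 * c) * (Gamma (c + 1))⁻¹) *
      ((2 : ℂ) ^ (1 + 2 * c - a))⁻¹ = Gamma (c + 1 / 2) * (Gamma (a / 2 + 1 / 2))⁻¹ :=
    gamma_quotient_negOne_one hA' hGa hN hT d1 d2 hp
  have k2 : Gamma (a / 2 + 1 / 2) * (Gamma a)⁻¹ * (Gamma (1 + 2 * c) * (Gamma (c + 1))⁻¹) *
      ((2 : ℂ) ^ (1 + 2 * c - a))⁻¹ = Gamma (c + 1 / 2) * (Gamma (a / 2))⁻¹ :=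
    gamma_quotient_negOne_one hA hGa hN hT (by rw [mul_comm, d1]) d2 hp
  clear d1 d2 hp hAA hA hA' hN hGa hP hT hq
  apply mul_left_cancel₀ hab0
  rw [h, watsonZeroOne, watsonZeroOne, watsonNegOneOne,
    show (a + 1) / 2 + b / 2 + 1 / 2 = a / 2 + b / 2 + 1 by ring,
    show a / 2 + (b + 1) / 2 + 1 / 2 = a / 2 + b / 2 + 1 by ring,
    show c - (a + 1) / 2 - b / 2 + 1 / 2 = c - a / 2 - b / 2 by ring,
    show c - a / 2 - (b + 1) / 2 + 1 / 2 = c - a / 2 - b / 2 by ring,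
    show (a + 1) / 2 + 1 / 2 = a / 2 + 1 by ring,
    show (b + 1) / 2 + 1 / 2 = b / 2 + 1 by ring,
    show c - (a + 1) / 2 + 1 / 2 = c - a / 2 by ring,
    show c - (b + 1) / 2 + 1 / 2 = c - b / 2 by ring,
    show c - (a + 1) / 2 + 1 = c - a / 2 + 1 / 2 by ring,
    show c - (b + 1) / 2 + 1 = c - b / 2 + 1 / 2 by ring,
    show (a + 1) / 2 = a / 2 + 1 / 2 by ring,
    show (b + 1) / 2 = b / 2 + 1 / 2 by ring,
    show c - b / 2 + 1 = 1 + c - b / 2 by ring, show c - b / 2 + 1 / 2 = 1 / 2 + c - b / 2 by ring,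
    g1, g2, g5, g6]
  generalize Gamma (a / 2 + 1) = A₁ at *
  generalize Gamma (b / 2 + 1) = B₁ at *
  generalize Gamma (a / 2 + 1 / 2) = A' at *
  generalize Gamma (b / 2 + 1 / 2) = B' at *
  generalize Gamma (a / 2) = A at *
  generalize Gamma (b / 2) = B at *
  generalize Gamma (c - a / 2 + 1) = C₁ at *
  generalize Gamma (1 + c - b / 2) = D₁ at *
  generalize Gamma (c - a / 2 + 1 / 2) = C' at *
  generalize Gamma (1 / 2 + c - b / 2) = D' at *
  generalize Gamma (a / 2 + b / 2) = E at *
  generalize Gamma (c - a / 2 - b / 2) = S at *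
  generalize Gamma (1 + 2 * c) = M at *
  generalize Gamma (c + 1) = N at *
  generalize Gamma (c + 1 / 2) = R at *
  generalize (2 : ℂ) ^ (1 + 2 * c - a) = T at *
  generalize (Real.sqrt Real.pi : ℂ) = q at *
  generalize Gamma a = G at *
  rw [div_eq_mul_inv _ (T * N * G), div_eq_mul_inv A, div_eq_mul_inv A']
  simp only [mul_inv]
  linear_combination -(a + b) * q * E * (c - a / 2 - b / 2) * S * (D₁⁻¹ * C'⁻¹ * B⁻¹ * k1 +
    D'⁻¹ * C₁⁻¹ * B'⁻¹ * k2)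
    - 2 * q * R * (a / 2 + b / 2) * E * S * (c - a / 2) * B'⁻¹ * C₁⁻¹ * D'⁻¹ * g3
    - 2 * q * R * (a / 2 + b / 2) * E * S * (c - b / 2) * A'⁻¹ * C'⁻¹ * D₁⁻¹ * g4

theorem tsum_watson_one_zero {a b c e : ℂ} (h2e : 2 * e = a + b + 2) (he : ¬ IsNonposInt e)
    (ha0 : ¬ IsNonposInt a) (hca : ¬ IsNonposInt (2 * c - a)) (hab : a ≠ b) (ha : a.re < -2)
    (hb : b.re < -2) (hc : 0 < c.re) :
    ∑' k, hyp3F2Term a b c e (2 * c) k = watsonOneZero a b c := by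
  have her : 2 * e.re = a.re + b.re + 2 := by simpa using congrArg re h2e
  have h := tsum_hyp3F2_upper_sub (a := a) (b := b) (c := c) (e := e) (f := 2 * c)
    (by simp; linarith)
  rw [tsum_watson (a := a) (b := b + 1) (by linear_combination h2e) he (by linarith)
      (by simp; linarith) hc,
    tsum_watson (a := a + 1) (b := b) (by linear_combination h2e) he (by simp; linarith) (by linarith) hc] at h
  have hba : b - a ≠ 0 := fun h => hab (by linear_combination -h)
  have hs : c - a / 2 - b / 2 ≠ 0 := Complex.ne_zero_of_re_pos (by simp; linarith)
  have g2 := Gamma_eq_mul (z := c - a / 2 - b / 2) (w := 1 + c - a / 2 - b / 2) (by ring) hs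
  have g3 := inv_Gamma_eq_mul (z := a / 2) (w := a / 2 + 1) rfl
  have g4 := inv_Gamma_eq_mul (z := b / 2) (w := b / 2 + 1) rfl
  have d1 := Gamma_mul_Gamma_add_half (a / 2)
  have d2 := Gamma_mul_Gamma_add_half c
  have d3 := Gamma_mul_Gamma_add_half (c - a / 2)
  rw [mul_div_cancel₀ a two_ne_zero] at d1
  rw [show 2 * (c - a / 2) = 2 * c - a by ring, show c - a / 2 + 1 / 2 = 1 / 2 - a / 2 + c by ring]
    at d3
  have hp : (2 : ℂ) ^ (1 - a) * (2 : ℂ) ^ (1 - (2 * c - a)) = 2 * (2 : ℂ) ^ (1 - 2 * c) := by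
    rw [← cpow_add _ _ two_ne_zero, show 1 - a + (1 - (2 * c - a)) = 1 + (1 - 2 * c) by ring,
      cpow_add _ _ two_ne_zero, cpow_one]
  have hP : ∀ z : ℂ, (2 : ℂ) ^ z ≠ 0 := fun z => by simp
  have hq : (Real.sqrt Real.pi : ℂ) ≠ 0 := by
    exact_mod_cast (Real.sqrt_pos.2 Real.pi_pos).ne'
  have hGa := Gamma_ne_zero_of_not_isNonposInt ha0
  have hZ := Gamma_ne_zero_of_not_isNonposInt hca
  have hN : Gamma c ≠ 0 := Gamma_ne_zero_of_re_pos hc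
  have hAA : Gamma (a / 2) * Gamma (a / 2 + 1 / 2) ≠ 0 := by
    rw [d1]
    exact mul_ne_zero (mul_ne_zero hGa (hP _)) hq
  have hCC : Gamma (c - a / 2) * Gamma (1 / 2 - a / 2 + c) ≠ 0 := by
    rw [d3]
    exact mul_ne_zero (mul_ne_zero hZ (hP _)) hq
  have k1 := gamma_quotient_one_zero (right_ne_zero_of_mul hAA) (right_ne_zero_of_mul hCC) hGa hN hZ
    d1 d2 d3 hp
  have k2 := gamma_quotient_one_zero (left_ne_zero_of_mul hAA) (left_ne_zero_of_mul hCC) hGa hN hZ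
    ((mul_comm _ _).trans d1) d2 ((mul_comm _ _).trans d3) hp
  have hden : (b - a) * ((b / 2 - a / 2)⁻¹ * (c - a / 2 - b / 2)⁻¹) * (c - a / 2 - b / 2) = 2 := by
    rw [show b / 2 - a / 2 = (b - a) / 2 by ring]
    generalize c - a / 2 - b / 2 = s at hs
    field_simp
  clear d1 d2 d3 hp hP hAA hCC hN hGa hZ hq
  apply mul_left_cancel₀ hba
  rw [h, watsonZeroZero, watsonZeroZero, watsonOneZero,
    show (a + 1) / 2 + b / 2 + 1 / 2 = 1 + a / 2 + b / 2 by ring,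
    show a / 2 + (b + 1) / 2 + 1 / 2 = 1 + a / 2 + b / 2 by ring,
    show c - (a + 1) / 2 - b / 2 + 1 / 2 = c - a / 2 - b / 2 by ring,
    show c - a / 2 - (b + 1) / 2 + 1 / 2 = c - a / 2 - b / 2 by ring,
    show (a + 1) / 2 + 1 / 2 = a / 2 + 1 by ring,
    show (b + 1) / 2 + 1 / 2 = b / 2 + 1 by ring,
    show c - (a + 1) / 2 + 1 / 2 = c - a / 2 by ring,
    show c - (b + 1) / 2 + 1 / 2 = c - b / 2 by ring,
    show c - a / 2 + 1 / 2 = 1 / 2 - a / 2 + c by ring,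
    show c - b / 2 + 1 / 2 = 1 / 2 - b / 2 + c by ring, g2]
  generalize Gamma (a / 2 + 1) = A₁ at *
  generalize Gamma (b / 2 + 1) = B₁ at *
  generalize Gamma (a / 2 + 1 / 2) = A' at *
  generalize Gamma (b / 2 + 1 / 2) = B' at *
  generalize Gamma (a / 2) = A at *
  generalize Gamma (b / 2) = B at *
  generalize Gamma (c - a / 2) = C at *
  generalize Gamma (c - b / 2) = D at *
  generalize Gamma (1 / 2 - a / 2 + c) = C' at *
  generalize Gamma (1 / 2 - b / 2 + c) = D' at *
  generalize Gamma (1 + a / 2 + b / 2) = E at *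
  generalize Gamma (c - a / 2 - b / 2) = S at *
  generalize Gamma (2 * c) = M at *
  generalize Gamma (2 * c - a) = Z at *
  generalize Gamma (c + 1 / 2) = R at *
  generalize Gamma c = N at *
  generalize (Real.sqrt Real.pi : ℂ) = q at *
  generalize Gamma a = G at *
  generalize hs' : c - a / 2 - b / 2 = s at *
  generalize hd : b / 2 - a / 2 = d at *
  rw [div_eq_mul_inv _ (Z * N * G * d * s), div_eq_mul_inv _ (D * B), div_eq_mul_inv _ (D' * B')]
  simp only [mul_inv]
  linear_combination -(b - a) * d⁻¹ * s⁻¹ * s * E * S / 2 *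
      (D⁻¹ * B⁻¹ * k1 - D'⁻¹ * B'⁻¹ * k2)
    - q * R * E * S * (A'⁻¹ * C'⁻¹ * D⁻¹ * B⁻¹ - A⁻¹ * C⁻¹ * D'⁻¹ * B'⁻¹) * hden
    - 2 * q * R * E * S * (A'⁻¹ * C'⁻¹ * D⁻¹ * g4 - B'⁻¹ * C⁻¹ * D'⁻¹ * g3)

theorem tsum_watson_one_negOne {a b c e : ℂ} (h2e : 2 * e = a + b + 2) (he : ¬ IsNonposInt e)
    (ha0 : ¬ IsNonposInt (a + 1)) (hcb : ¬ IsNonposInt (2 * c - b)) (hab : a ≠ b) (ha : a.re < -2)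
    (hb : b.re < -2) (hc : 1 < c.re) :
    ∑' k, hyp3F2Term a b c e (2 * c - 1) k = watsonOneNegOne a b c := by
  have her : 2 * e.re = a.re + b.re + 2 := by simpa using congrArg re h2e
  have h := tsum_hyp3F2_upper_sub (a := a) (b := b) (c := c) (e := e) (f := 2 * c - 1)
    (by simp; linarith)
  rw [tsum_watson_zero_negOne (a := a) (b := b + 1) (by linear_combination h2e) he (by linarith)
      (by simp; linarith) hc,
    tsum_watson_zero_negOne (a := a + 1) (b := b) (by linear_combination h2e) he (by simp; linarith) (by linarith) hc]
    at h
  have hba : b - a ≠ 0 := fun h => hab (by linear_combination -h)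
  have hs : c - a / 2 - b / 2 - 1 ≠ 0 := Complex.ne_zero_of_re_pos (by simp; linarith)
  have g2 := Gamma_eq_mul (z := c - a / 2 - b / 2 - 1) (w := c - a / 2 - b / 2) (by ring) hs
  have g3 := inv_Gamma_eq_mul (z := a / 2) (w := 1 + a / 2) (by ring)
  have g4 := inv_Gamma_eq_mul (z := b / 2) (w := b / 2 + 1) rfl
  have g5 := inv_Gamma_eq_mul (z := c - a / 2 - 1) (w := c - a / 2) (by ring)
  have g6 := inv_Gamma_eq_mul (z := c - b / 2 - 1) (w := c - b / 2) (by ring)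
  have g7 := inv_Gamma_eq_mul (z := c - b / 2 - 1 / 2) (w := c - b / 2 + 1 / 2) (by ring)
  have d1 := Gamma_mul_Gamma_add_half (a / 2 + 1 / 2)
  have d2 := Gamma_mul_Gamma_add_half (c - b / 2)
  rw [show 2 * (a / 2 + 1 / 2) = a + 1 by ring, show a / 2 + 1 / 2 + 1 / 2 = 1 + a / 2 by ring]
    at d1
  rw [show 2 * (c - b / 2) = 2 * c - b by ring] at d2
  have hp : (2 : ℂ) ^ (1 - (a + 1)) * (2 : ℂ) ^ (1 - (2 * c - b)) *
      (2 : ℂ) ^ (a - b + 2 * c - 1) = 1 := by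
    rw [← cpow_add _ _ two_ne_zero, ← cpow_add _ _ two_ne_zero,
      show 1 - (a + 1) + (1 - (2 * c - b)) + (a - b + 2 * c - 1) = 0 by ring, cpow_zero]
  have hP : ∀ z : ℂ, (2 : ℂ) ^ z ≠ 0 := fun z => by simp
  have hq : (Real.sqrt Real.pi : ℂ) ≠ 0 := by
    exact_mod_cast (Real.sqrt_pos.2 Real.pi_pos).ne'
  have hGa := Gamma_ne_zero_of_not_isNonposInt ha0
  have hZ := Gamma_ne_zero_of_not_isNonposInt hcb
  have hAA : Gamma (a / 2 + 1 / 2) * Gamma (1 + a / 2) ≠ 0 := by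
    rw [d1]
    exact mul_ne_zero (mul_ne_zero hGa (hP _)) hq
  have hVV : Gamma (c - b / 2) * Gamma (c - b / 2 + 1 / 2) ≠ 0 := by
    rw [d2]
    exact mul_ne_zero (mul_ne_zero hZ (hP _)) hq
  have k1 := gamma_quotient_one_negOne (left_ne_zero_of_mul hAA) (left_ne_zero_of_mul hVV) hGa hZ hq
    d1 d2 hp
  have k2 := gamma_quotient_one_negOne (right_ne_zero_of_mul hAA) (right_ne_zero_of_mul hVV) hGa hZ hq
    ((mul_comm _ _).trans d1) ((mul_comm _ _).trans d2) hp
  have hden : (b - a) * (b / 2 - a / 2)⁻¹ = 2 := by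
    rw [show b / 2 - a / 2 = (b - a) / 2 by ring]
    field_simp
  clear d1 d2 hp hP hAA hVV hGa hZ hq
  apply mul_left_cancel₀ hba
  rw [h, watsonZeroNegOne, watsonZeroNegOne, watsonOneNegOne,
    show (a + 1) / 2 + b / 2 + 1 / 2 = 1 + a / 2 + b / 2 by ring,
    show a / 2 + (b + 1) / 2 + 1 / 2 = 1 + a / 2 + b / 2 by ring,
    show c - (a + 1) / 2 - b / 2 - 1 / 2 = c - a / 2 - b / 2 - 1 by ring,
    show c - a / 2 - (b + 1) / 2 - 1 / 2 = c - a / 2 - b / 2 - 1 by ring,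
    show (a + 1) / 2 + 1 / 2 = 1 + a / 2 by ring,
    show (b + 1) / 2 + 1 / 2 = b / 2 + 1 by ring,
    show c - 1 / 2 - (a + 1) / 2 = c - a / 2 - 1 by ring,
    show c - 1 / 2 - (b + 1) / 2 = c - b / 2 - 1 by ring,
    show c - (a + 1) / 2 = c - a / 2 - 1 / 2 by ring,
    show c - (b + 1) / 2 = c - b / 2 - 1 / 2 by ring,
    show c - 1 / 2 - a / 2 = c - a / 2 - 1 / 2 by ring,
    show c - 1 / 2 - b / 2 = c - b / 2 - 1 / 2 by ring,
    show (a + 1) / 2 = a / 2 + 1 / 2 by ring,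
    show (b + 1) / 2 = b / 2 + 1 / 2 by ring, g2]
  generalize Gamma (1 + a / 2) = A₁ at *
  generalize Gamma (b / 2 + 1) = B₁ at *
  generalize Gamma (a / 2 + 1 / 2) = A' at *
  generalize Gamma (b / 2 + 1 / 2) = B' at *
  generalize Gamma (a / 2) = A at *
  generalize Gamma (b / 2) = B at *
  generalize Gamma (c - a / 2) = C at *
  generalize Gamma (c - b / 2) = D at *
  generalize Gamma (c - a / 2 - 1) = C₁ at *
  generalize Gamma (c - b / 2 - 1) = D₁ at *
  generalize Gamma (c - a / 2 - 1 / 2) = C₂ at *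
  generalize Gamma (c - b / 2 - 1 / 2) = D₂ at *
  generalize Gamma (c - b / 2 + 1 / 2) = D' at *
  generalize Gamma (1 + a / 2 + b / 2) = E at *
  generalize Gamma (c - a / 2 - b / 2 - 1) = S at *
  generalize Gamma (2 * c - b) = Z at *
  generalize Gamma (c - 1 / 2) = R at *
  generalize (2 : ℂ) ^ (a - b + 2 * c - 1) = T at *
  generalize (Real.sqrt Real.pi : ℂ) = q at *
  generalize Gamma (a + 1) = G at *
  generalize hd : b / 2 - a / 2 = d at *
  rw [div_eq_mul_inv _ (q * G * Z * d), div_eq_mul_inv _ (C₂ * B), div_eq_mul_inv _ (C * B'),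
    one_div (_ * _), one_div (_ * _), one_div (_ * _), one_div (_ * _)]
  simp only [mul_inv]
  -- the four products of `Γ⁻¹` combine to a multiple of the difference of two of them
  have lhs : b * (q * R * E * S * (A'⁻¹ * B₁⁻¹ * C₂⁻¹ * D₁⁻¹ + A⁻¹ * B'⁻¹ * C⁻¹ * D₂⁻¹)) -
      a * (q * R * E * S * (A₁⁻¹ * B'⁻¹ * C₁⁻¹ * D₂⁻¹ + A'⁻¹ * B⁻¹ * C₂⁻¹ * D⁻¹)) =
      2 * q * R * E * S * (c - a / 2 - b / 2 - 1) *
        (A'⁻¹ * B⁻¹ * C₂⁻¹ * D⁻¹ - A⁻¹ * B'⁻¹ * C⁻¹ * D₂⁻¹) := by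
    rw [g5, g6]
    linear_combination -2 * q * R * E * S * ((c - b / 2 - 1) * A'⁻¹ * C₂⁻¹ * D⁻¹ * g4 -
      (c - a / 2 - 1) * B'⁻¹ * C⁻¹ * D₂⁻¹ * g3)
  rw [lhs, g3, g7]
  linear_combination -(b - a) * d⁻¹ * R * E * S * (c - a / 2 - b / 2 - 1) *
      (C₂⁻¹ * B⁻¹ * k1 - a * (2 * c - b - 1) / 4 * C⁻¹ * B'⁻¹ * k2)
    - q * R * E * S * (c - a / 2 - b / 2 - 1) * (A'⁻¹ * B⁻¹ * C₂⁻¹ * D⁻¹ -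
      a * (2 * c - b - 1) / 4 * A₁⁻¹ * B'⁻¹ * C⁻¹ * D'⁻¹) * hden

/-! ### Sets that are generic along complex lines -/

/-- An open subset of `ℂ³` that every complex line meeting it leaves in only countably many
points. -/
def LineGeneric (S : Set (ℂ × ℂ × ℂ)) : Prop :=
  IsOpen S ∧ ∀ p ∈ S, ∀ d : ℂ × ℂ × ℂ, {t : ℂ | p + t • d ∉ S}.Countable

theorem LineGeneric.inter {S T : Set (ℂ × ℂ × ℂ)} (hS : LineGeneric S) (hT : LineGeneric T) :
    LineGeneric (S ∩ T) := by
  refine ⟨hS.1.inter hT.1, fun p hp d => ?_⟩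
  refine ((hS.2 p hp.1 d).union (hT.2 p hp.2 d)).mono fun t ht => ?_
  exact not_and_or.1 ht

theorem LineGeneric.isConnected {S : Set (ℂ × ℂ × ℂ)} (hS : LineGeneric S) (hne : S.Nonempty) :
    IsConnected S := by
  refine ⟨hne, isPreconnected_of_forall_pair fun x hx y hy => ?_⟩
  have hc : IsConnected {t : ℂ | x + t • (y - x) ∉ S}ᶜ :=
    (hS.2 x hx (y - x)).isConnected_compl_of_one_lt_rank (by rw [Complex.rank_real_complex]; simp)
  refine ⟨(fun t : ℂ => x + t • (y - x)) '' {t : ℂ | x + t • (y - x) ∉ S}ᶜ, ?_, ⟨0, ?_, ?_⟩,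
    ⟨1, ?_, ?_⟩, hc.isPreconnected.image _ (by fun_prop)⟩
  · rintro _ ⟨t, ht, rfl⟩
    exact not_not.1 ht
  · simpa using hx
  · simp
  · simpa using hy
  · simp

theorem isNonposInt_iff_inv_Gamma (z : ℂ) : IsNonposInt z ↔ (Gamma z)⁻¹ = 0 := by
  rw [inv_eq_zero, Gamma_eq_zero_iff, IsNonposInt]

theorem isOpen_not_isNonposInt : IsOpen {z : ℂ | ¬ IsNonposInt z} := by
  simp only [isNonposInt_iff_inv_Gamma]
  exact isOpen_ne_fun differentiable_one_div_Gamma.continuous continuous_const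

theorem countable_add_mul_eq {u v w : ℂ} (h : u ≠ w) : {t : ℂ | u + t * v = w}.Countable := by
  refine Set.Subsingleton.countable fun t (ht : _ = _) t' (ht' : _ = _) => ?_
  have hv : v ≠ 0 := by
    rintro rfl
    exact h (by simpa using ht)
  exact mul_right_cancel₀ hv (add_left_cancel (ht.trans ht'.symm))

theorem lineGeneric_ne_zero (x y z w : ℂ) :
    LineGeneric {p | x * p.1 + y * p.2.1 + z * p.2.2 + w ≠ 0} := by
  refine ⟨isOpen_ne_fun (by fun_prop) continuous_const, fun p hp d => ?_⟩
  refine (countable_add_mul_eq (v := x * d.1 + y * d.2.1 + z * d.2.2) hp).mono fun t ht => ?_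
  have := not_not.1 ht
  simp only [Prod.fst_add, Prod.snd_add, Prod.smul_fst, Prod.smul_snd, smul_eq_mul] at this
  simp only [Set.mem_ofPred_eq]
  linear_combination this

theorem lineGeneric_not_isNonposInt (x y z w : ℂ) :
    LineGeneric {p | ¬ IsNonposInt (x * p.1 + y * p.2.1 + z * p.2.2 + w)} := by
  refine ⟨isOpen_not_isNonposInt.preimage (by fun_prop), fun p hp d => ?_⟩
  refine (Set.countable_iUnion fun k : ℕ => countable_add_mul_eq
    (v := x * d.1 + y * d.2.1 + z * d.2.2) fun h => hp ⟨k, h⟩).mono fun t ht => ?_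
  obtain ⟨k, hk⟩ := not_not.1 ht
  simp only [Prod.fst_add, Prod.snd_add, Prod.smul_fst, Prod.smul_snd, smul_eq_mul] at hk
  refine Set.mem_iUnion.2 ⟨k, ?_⟩
  simp only [Set.mem_ofPred_eq]
  linear_combination hk

/-- A half-plane minus a countable set is connected, since it is homeomorphic to the plane minus a
countable set. -/
theorem isPreconnected_halfPlane_diff_countable (r : ℝ) {C : Set ℂ} (hC : C.Countable) :
    IsPreconnected ({t : ℂ | r < t.re} \ C) := by
  set φ : ℂ → ℂ := fun z => ⟨r + Real.exp z.re, z.im⟩ with hφ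
  have hcont : Continuous φ := by
    have : φ = fun z => ((r + Real.exp z.re : ℝ) : ℂ) + (z.im : ℂ) * I := by
      ext z
      exact Complex.ext (by simp [hφ, exp_ofReal_re]) (by simp [hφ, exp_ofReal_im])
    rw [this]
    fun_prop
  have hinj : Function.Injective φ := fun z w h => by
    have h1 : r + Real.exp z.re = r + Real.exp w.re := (Complex.ext_iff.1 h).1
    have h2 : z.im = w.im := (Complex.ext_iff.1 h).2
    exact Complex.ext (Real.exp_injective (add_left_cancel h1)) h2
  have himage : {t : ℂ | r < t.re} \ C = φ '' (φ ⁻¹' C)ᶜ := by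
    ext t
    constructor
    · rintro ⟨ht, htC⟩
      have hφt : φ ⟨Real.log (t.re - r), t.im⟩ = t := by
        apply Complex.ext
        · simp only [hφ]
          rw [Real.exp_log (sub_pos.2 ht)]
          ring
        · rfl
      exact ⟨_, by simpa [hφt] using htC, hφt⟩
    · rintro ⟨z, hz, rfl⟩
      exact ⟨by simp [hφ, Real.exp_pos], hz⟩
  rw [himage]
  exact ((hC.preimage_of_injOn hinj.injOn).isConnected_compl_of_one_lt_rank
    (by rw [Complex.rank_real_complex]; simp)).isPreconnected.image _ hcont.continuousOn

/-! ### Analytic continuation along lines -/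

theorem watsonExcess_line (m n : ℤ) (a b c d₁ d₂ d₃ t : ℂ) :
    watsonExcess m n (a + t * d₁) (b + t * d₂) (c + t * d₃) =
      watsonExcess m n a b c + t * (d₃ - (d₁ + d₂) / 2) := by
  simp only [watsonExcess, watsonE, watsonF]
  ring

theorem differentiable_watsonE_line (m : ℤ) (a b d₁ d₂ : ℂ) :
    Differentiable ℂ fun t : ℂ => watsonE m (a + t * d₁) (b + t * d₂) := by
  unfold watsonE
  fun_prop

theorem differentiable_watsonF_line (n : ℤ) (c d₃ : ℂ) :
    Differentiable ℂ fun t : ℂ => watsonF n (c + t * d₃) := by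
  unfold watsonF
  fun_prop

section Line

variable {m n : ℤ} {P : ℂ → ℂ → ℂ → Prop} {G : ℂ → ℂ → ℂ → ℂ}

theorem LineGeneric.countable_line (hP : LineGeneric {p | P p.1 p.2.1 p.2.2}) {a b c : ℂ}
    (h : P a b c) (d₁ d₂ d₃ : ℂ) :
    {t : ℂ | ¬ P (a + t * d₁) (b + t * d₂) (c + t * d₃)}.Countable :=
  hP.2 (a, b, c) h (d₁, d₂, d₃)

theorem LineGeneric.isOpen_line (hP : LineGeneric {p | P p.1 p.2.1 p.2.2}) (a b c d₁ d₂ d₃ : ℂ) :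
    IsOpen {t : ℂ | P (a + t * d₁) (b + t * d₂) (c + t * d₃)} :=
  hP.1.preimage (f := fun t : ℂ => (a + t * d₁, b + t * d₂, c + t * d₃)) (by fun_prop)

theorem analyticOnNhd_line
    (hG : AnalyticOnNhd ℂ (fun p : ℂ × ℂ × ℂ => G p.1 p.2.1 p.2.2) {p | P p.1 p.2.1 p.2.2})
    (a b c d₁ d₂ d₃ : ℂ) :
    AnalyticOnNhd ℂ (fun t : ℂ => G (a + t * d₁) (b + t * d₂) (c + t * d₃))
      {t : ℂ | P (a + t * d₁) (b + t * d₂) (c + t * d₃)} := by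
  intro t ht
  have hline : AnalyticAt ℂ (fun t : ℂ => (a + t * d₁, b + t * d₂, c + t * d₃)) t :=
    Differentiable.analyticAt (by fun_prop) t
  exact AnalyticAt.comp (g := fun p : ℂ × ℂ × ℂ => G p.1 p.2.1 p.2.2) (hG _ ht) hline

/-- The set of points of a half-plane outside a countable set is nonempty. -/
theorem exists_re_gt_notMem {C : Set ℂ} (hC : C.Countable) (r : ℝ) : ∃ t : ℂ, r < t.re ∧ t ∉ C := by
  have ho : IsOpen {t : ℂ | r < t.re} := isOpen_lt continuous_const Complex.continuous_re
  obtain ⟨t, ht, htC⟩ := (hC.dense_compl ℝ).inter_open_nonempty _ ho ⟨(r + 1 : ℝ), by simp⟩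
  exact ⟨t, ht, htC⟩

/-- Extension of a closed form from the parameters far out in the direction `(-1, -1, 1)` to all
parameters of positive excess. Along that direction the excess grows with slope `2`, so the part of
the line that lies in the region of convergence is a half-plane. -/
theorem watsonW_eq_of_base (hP : LineGeneric {p | P p.1 p.2.1 p.2.2})
    (hreg : ∀ a b c, P a b c → WatsonRegular m n a b c)
    (hG : AnalyticOnNhd ℂ (fun p : ℂ × ℂ × ℂ => G p.1 p.2.1 p.2.2) {p | P p.1 p.2.1 p.2.2})
    {B : ℝ} (hbase : ∀ a b c, P a b c → a.re < -B → b.re < -B → B < c.re →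
      watsonW m n a b c = G a b c) {a b c : ℂ} (h : P a b c)
    (hs : 0 < (watsonExcess m n a b c).re) : watsonW m n a b c = G a b c := by
  set σ := (watsonExcess m n a b c).re with hσ
  set bad := {t : ℂ | ¬ P (a + t * -1) (b + t * -1) (c + t * 1)} with hbad
  have hbadc : bad.Countable := hP.countable_line h _ _ _
  set U := {t : ℂ | -σ / 2 < t.re} \ bad with hU
  have hUpre : IsPreconnected U := isPreconnected_halfPlane_diff_countable _ hbadc
  have hPU : ∀ t ∈ U, P (a + t * -1) (b + t * -1) (c + t * 1) := fun t ht => not_not.1 ht.2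
  have hsU : ∀ t ∈ U, 0 < (watsonExcess m n (a + t * -1) (b + t * -1) (c + t * 1)).re := by
    intro t ht
    have h1 : -σ / 2 < t.re := ht.1
    rw [watsonExcess_line, add_re, ← hσ, show (1 : ℂ) - (-1 + -1) / 2 = (2 : ℝ) by norm_num,
      re_mul_ofReal]
    linarith
  have hUo : IsOpen U := by
    have : U = {t : ℂ | -σ / 2 < t.re} ∩ {t : ℂ | P (a + t * -1) (b + t * -1) (c + t * 1)} := by
      ext t
      simp [hU, hbad]
    rw [this]
    exact (isOpen_lt continuous_const Complex.continuous_re).inter (hP.isOpen_line _ _ _ _ _ _)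
  have hW : AnalyticOnNhd ℂ
      (fun t : ℂ => watsonW m n (a + t * -1) (b + t * -1) (c + t * 1)) U := by
    refine DifferentiableOn.analyticOnNhd ?_ hUo
    exact differentiableOn_tsum_hyp3F2Term hUo (by fun_prop) (by fun_prop) (by fun_prop)
      (differentiable_watsonE_line m a b _ _) (differentiable_watsonF_line n c _)
      (fun t ht => (hreg _ _ _ (hPU t ht)).1) (fun t ht => (hreg _ _ _ (hPU t ht)).2.1) hsU
  have hGU := (analyticOnNhd_line hG a b c (-1) (-1) 1).mono hPU
  set M := max (max (a.re + B) (b.re + B)) (max (B - c.re) (-σ / 2)) with hM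
  obtain ⟨t₀, ht₀, ht₀b⟩ := exists_re_gt_notMem hbadc M
  have hfar : ∀ t : ℂ, M < t.re → t ∉ bad →
      watsonW m n (a + t * -1) (b + t * -1) (c + t * 1) = G (a + t * -1) (b + t * -1) (c + t * 1) := by
    intro t ht htb
    simp only [hM, max_lt_iff] at ht
    refine hbase _ _ _ (not_not.1 htb) ?_ ?_ ?_ <;> simp <;> linarith [ht.1.1, ht.1.2, ht.2.1]
  have hMU : ∀ t : ℂ, M < t.re → t ∉ bad → t ∈ U := fun t ht htb =>
    ⟨lt_of_le_of_lt ((le_max_right _ _).trans (le_max_right _ _)) ht, htb⟩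
  have hev : (fun t : ℂ => watsonW m n (a + t * -1) (b + t * -1) (c + t * 1)) =ᶠ[𝓝 t₀]
      fun t => G (a + t * -1) (b + t * -1) (c + t * 1) := by
    filter_upwards [hUo.mem_nhds (hMU t₀ ht₀ ht₀b),
      (isOpen_lt continuous_const Complex.continuous_re).mem_nhds ht₀] with t ht htM
    exact hfar t htM ht.2
  have h0 : (0 : ℂ) ∈ U := ⟨by simp; linarith, by simpa [hbad] using h⟩
  simpa using hW.eqOn_of_preconnected_of_eventuallyEq hGU hUpre (hMU t₀ ht₀ ht₀b) hev h0

/-- A terminating series has the expected sum even where the excess has negative real part: along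
a line in a direction that preserves termination, both sides are analytic off a countable set. -/
theorem hasSum_watsonTerm_of_terminating (hP : LineGeneric {p | P p.1 p.2.1 p.2.2})
    (hreg : ∀ a b c, P a b c → WatsonRegular m n a b c)
    (hG : AnalyticOnNhd ℂ (fun p : ℂ × ℂ × ℂ => G p.1 p.2.1 p.2.2) {p | P p.1 p.2.1 p.2.2})
    (hW : ∀ a b c, P a b c → 0 < (watsonExcess m n a b c).re → watsonW m n a b c = G a b c)
    {a b c : ℂ} (h : P a b c) {d₁ d₂ d₃ : ℂ} {r : ℝ} (hr : 0 < r)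
    (hd : d₃ - (d₁ + d₂) / 2 = r) {N : ℕ}
    (hN : ∀ t : ℂ, ∀ k, N ≤ k → watsonTerm m n (a + t * d₁) (b + t * d₂) (c + t * d₃) k = 0) :
    HasSum (watsonTerm m n a b c) (G a b c) := by
  set U := {t : ℂ | P (a + t * d₁) (b + t * d₂) (c + t * d₃)} with hU
  have hUo : IsOpen U := hP.isOpen_line _ _ _ _ _ _
  have hbad := hP.countable_line h d₁ d₂ d₃
  have hUpre : IsPreconnected U := by
    have := (hbad.isConnected_compl_of_one_lt_rank
      (by rw [Complex.rank_real_complex]; simp)).isPreconnected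
    convert this using 1
    ext t
    simp [hU]
  have hsum : ∀ t : ℂ, HasSum (watsonTerm m n (a + t * d₁) (b + t * d₂) (c + t * d₃))
      (∑ k ∈ Finset.range N, watsonTerm m n (a + t * d₁) (b + t * d₂) (c + t * d₃) k) := fun t =>
    hasSum_sum_of_ne_finset_zero fun k hk => hN t k (by simpa using hk)
  have hF : AnalyticOnNhd ℂ (fun t : ℂ =>
      ∑ k ∈ Finset.range N, watsonTerm m n (a + t * d₁) (b + t * d₂) (c + t * d₃) k) U := by
    refine DifferentiableOn.analyticOnNhd (fun t ht => ?_) hUo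
    refine (DifferentiableAt.fun_sum fun k _ => ?_).differentiableWithinAt
    have hr := hreg _ _ _ ht
    exact differentiableAt_hyp3F2Term (by fun_prop) (by fun_prop) (by fun_prop)
      (differentiable_watsonE_line m a b _ _ t) (differentiable_watsonF_line n c _ t) hr.1 hr.2.1 k
  have hGU := analyticOnNhd_line hG a b c d₁ d₂ d₃
  set M := -(watsonExcess m n a b c).re / r with hM
  obtain ⟨t₀, ht₀, ht₀b⟩ := exists_re_gt_notMem hbad M
  have ht₀U : t₀ ∈ U := not_not.1 ht₀b
  have hev : (fun t : ℂ => ∑ k ∈ Finset.range N,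
      watsonTerm m n (a + t * d₁) (b + t * d₂) (c + t * d₃) k) =ᶠ[𝓝 t₀]
      fun t => G (a + t * d₁) (b + t * d₂) (c + t * d₃) := by
    filter_upwards [hUo.mem_nhds ht₀U,
      (isOpen_lt continuous_const Complex.continuous_re).mem_nhds ht₀] with t ht htM
    rw [← (hsum t).tsum_eq]
    refine hW _ _ _ ht ?_
    have htM' : M < t.re := htM
    rw [hM, div_lt_iff₀ hr] at htM'
    rw [watsonExcess_line, hd, add_re, re_mul_ofReal]
    linarith
  have h0 : (0 : ℂ) ∈ U := by simpa [hU] using h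
  have key := hF.eqOn_of_preconnected_of_eventuallyEq hGU hUpre ht₀U hev h0
  have hs0 := hsum 0
  simp only [zero_mul, add_zero] at key hs0
  rwa [key] at hs0

/-- A closed form that holds far out, and is analytic on a generic set of parameters, evaluates
the series on that set. -/
theorem watsonEvaluation_of_base (hP : LineGeneric {p | P p.1 p.2.1 p.2.2})
    (hreg : ∀ a b c, P a b c → WatsonRegular m n a b c)
    (hG : AnalyticOnNhd ℂ (fun p : ℂ × ℂ × ℂ => G p.1 p.2.1 p.2.2) {p | P p.1 p.2.1 p.2.2})
    (hne : ∃ a b c, P a b c ∧ 0 < (watsonExcess m n a b c).re)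
    {B : ℝ} (hbase : ∀ a b c, P a b c → a.re < -B → b.re < -B → B < c.re →
      watsonW m n a b c = G a b c) : WatsonEvaluation m n P G := by
  have hW : ∀ a b c, P a b c → 0 < (watsonExcess m n a b c).re → watsonW m n a b c = G a b c :=
    fun a b c h hs => watsonW_eq_of_base hP hreg hG hbase h hs
  have hzero : ∀ {z : ℂ} {N k : ℕ}, z = -(N : ℂ) → N + 1 ≤ k → (ascPochhammer ℂ k).eval z = 0 := by
    intro z N k hz hk
    rw [ascPochhammer_eval_eq_zero_iff]
    exact ⟨N, by omega, by rw [hz, neg_neg]⟩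
  refine ⟨?_, ?_⟩
  · rintro a b c h (hs | ⟨N, hN⟩ | ⟨N, hN⟩ | ⟨N, hN⟩)
    · rw [← hW a b c h hs]
      exact (summable_hyp3F2Term hs).hasSum
    -- the directions keep the nonpositive integer parameter fixed, and the excess grows along them
    · refine hasSum_watsonTerm_of_terminating hP hreg hG hW h (d₁ := 0) (d₂ := -1) (d₃ := 1)
        (r := 3 / 2) (N := N + 1) (by norm_num) (by norm_num) fun t k hk => ?_
      simp only [watsonTerm, hyp3F2Term]
      rw [hzero (z := a + t * 0) (by simpa using hN) hk]
      simp
    · refine hasSum_watsonTerm_of_terminating hP hreg hG hW h (d₁ := -1) (d₂ := 0) (d₃ := 1)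
        (r := 3 / 2) (N := N + 1) (by norm_num) (by norm_num) fun t k hk => ?_
      simp only [watsonTerm, hyp3F2Term]
      rw [hzero (z := b + t * 0) (by simpa using hN) hk]
      simp
    · refine hasSum_watsonTerm_of_terminating hP hreg hG hW h (d₁ := -1) (d₂ := -1) (d₃ := 0)
        (r := 1) (N := N + 1) (by norm_num) (by norm_num) fun t k hk => ?_
      simp only [watsonTerm, hyp3F2Term]
      rw [hzero (z := c + t * 0) (by simpa using hN) hk]
      simp
  · obtain ⟨a, b, c, h, hs⟩ := hne
    have hcont : Continuous fun p : ℂ × ℂ × ℂ => (watsonExcess m n p.1 p.2.1 p.2.2).re := by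
      simp only [watsonExcess, watsonE, watsonF]
      fun_prop
    have ho : IsOpen {p : ℂ × ℂ × ℂ | 0 < (watsonExcess m n p.1 p.2.1 p.2.2).re} :=
      isOpen_lt continuous_const hcont
    exact ⟨hP.1.inter ho, ⟨(a, b, c), h, hs⟩, fun p hp => hp.1, hP.1,
      hP.isConnected ⟨(a, b, c), h⟩, hG, fun p hp => hW _ _ _ hp.1 hp.2⟩

end Line

/-! ### Genericity and analyticity of the closed forms -/

theorem lineGeneric_watsonRegular (m n : ℤ) :
    LineGeneric {p | WatsonRegular m n p.1 p.2.1 p.2.2} := by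
  have h := (lineGeneric_not_isNonposInt (1 / 2) (1 / 2) 0 ((1 + m) / 2)).inter
    ((lineGeneric_not_isNonposInt 0 0 2 n).inter
      (lineGeneric_not_isNonposInt (-1 / 2) (-1 / 2) 1 ((1 + m) / 2 + n)))
  convert h using 1
  ext p
  simp only [WatsonRegular, watsonExcess, watsonE, watsonF, Set.mem_inter_iff, Set.mem_ofPred_eq]
  rw [show 1 / 2 * p.1 + 1 / 2 * p.2.1 + 0 * p.2.2 + (1 + m) / 2 = (p.1 + p.2.1 + 1 + m) / 2 by ring,
    show 0 * p.1 + 0 * p.2.1 + 2 * p.2.2 + n = 2 * p.2.2 + n by ring,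
    show -1 / 2 * p.1 + -1 / 2 * p.2.1 + 1 * p.2.2 + ((1 + m) / 2 + n) =
      (p.1 + p.2.1 + 1 + m) / 2 + (2 * p.2.2 + n) - p.1 - p.2.1 - p.2.2 by ring]

theorem not_isNonposInt_of_two_mul {z w : ℂ} (hw : ¬ IsNonposInt w) (h : w = 2 * z) :
    ¬ IsNonposInt z := by
  rintro ⟨k, rfl⟩
  exact hw ⟨2 * k, by rw [h]; push_cast; ring⟩

theorem not_isNonposInt_of_two_mul_sub_one {z w : ℂ} (hw : ¬ IsNonposInt w) (h : w = 2 * z - 1) :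
    ¬ IsNonposInt z := by
  rintro ⟨k, rfl⟩
  exact hw ⟨2 * k + 1, by rw [h]; push_cast; ring⟩

section Analytic

variable {E : Type*} [NormedAddCommGroup E] [NormedSpace ℂ E] {f : E → ℂ} {x : E}

theorem AnalyticAt.complex_Gamma (hf : AnalyticAt ℂ f x) (hx : ¬ IsNonposInt (f x)) :
    AnalyticAt ℂ (fun y => Gamma (f y)) x := by
  have ho : {z : ℂ | ¬ IsNonposInt z} ∈ 𝓝 (f x) := isOpen_not_isNonposInt.mem_nhds hx
  have hd : DifferentiableOn ℂ Gamma {z : ℂ | ¬ IsNonposInt z} := fun z hz =>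
    (differentiableAt_Gamma z fun k hk => hz ⟨k, hk⟩).differentiableWithinAt
  exact (hd.analyticAt ho).comp hf

theorem AnalyticAt.complex_Gamma_inv (hf : AnalyticAt ℂ f x) :
    AnalyticAt ℂ (fun y => (Gamma (f y))⁻¹) x :=
  (differentiable_one_div_Gamma.analyticAt (f x)).comp (g := fun z => (Gamma z)⁻¹) hf

theorem AnalyticAt.two_cpow (hf : AnalyticAt ℂ f x) :
    AnalyticAt ℂ (fun y => (2 : ℂ) ^ f y) x :=
  analyticAt_const.cpow hf (by simp)

end Analytic

attribute [local fun_prop] analyticAt_fst analyticAt_snd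

theorem analyticOnNhd_watsonZeroNegOne :
    AnalyticOnNhd ℂ (fun p : ℂ × ℂ × ℂ => watsonZeroNegOne p.1 p.2.1 p.2.2)
      {p | WatsonRegular 0 (-1) p.1 p.2.1 p.2.2} := by
  rintro ⟨a, b, c⟩ ⟨he, hf, hs⟩
  simp only [watsonExcess, watsonE, watsonF] at he hf hs
  push_cast at he hf hs
  have h1 : ¬ IsNonposInt (c - 1 / 2) := not_isNonposInt_of_two_mul hf (by ring)
  have h2 : ¬ IsNonposInt (a / 2 + b / 2 + 1 / 2) := by convert he using 2; ring
  have h3 : ¬ IsNonposInt (c - a / 2 - b / 2 - 1 / 2) := by convert hs using 2; ring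
  -- reciprocals of gamma functions are written as factors `Γ⁻¹`, which are entire
  have heq : (fun p : ℂ × ℂ × ℂ => watsonZeroNegOne p.1 p.2.1 p.2.2) = fun p =>
      (Real.sqrt Real.pi : ℂ) * Gamma (p.2.2 - 1 / 2) * Gamma (p.1 / 2 + p.2.1 / 2 + 1 / 2) *
        Gamma (p.2.2 - p.1 / 2 - p.2.1 / 2 - 1 / 2) *
      ((Gamma (p.1 / 2 + 1 / 2))⁻¹ * (Gamma (p.2.1 / 2 + 1 / 2))⁻¹ *
          (Gamma (p.2.2 - 1 / 2 - p.1 / 2))⁻¹ * (Gamma (p.2.2 - 1 / 2 - p.2.1 / 2))⁻¹ +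
        (Gamma (p.1 / 2))⁻¹ * (Gamma (p.2.1 / 2))⁻¹ * (Gamma (p.2.2 - p.1 / 2))⁻¹ *
          (Gamma (p.2.2 - p.2.1 / 2))⁻¹) := by
    funext p
    rw [watsonZeroNegOne, one_div (_ * _), one_div (_ * _)]
    simp only [mul_inv]
  rw [heq]
  refine .fun_mul (.fun_mul (.fun_mul (.fun_mul analyticAt_const (.complex_Gamma ?_ h1))
    (.complex_Gamma ?_ h2)) (.complex_Gamma ?_ h3))
    (.fun_add (.fun_mul (.fun_mul (.fun_mul (.complex_Gamma_inv ?_) (.complex_Gamma_inv ?_))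
      (.complex_Gamma_inv ?_)) (.complex_Gamma_inv ?_))
      (.fun_mul (.fun_mul (.fun_mul (.complex_Gamma_inv ?_) (.complex_Gamma_inv ?_))
      (.complex_Gamma_inv ?_)) (.complex_Gamma_inv ?_)))
  all_goals fun_prop

theorem analyticOnNhd_watsonNegOneOne :
    AnalyticOnNhd ℂ (fun p : ℂ × ℂ × ℂ => watsonNegOneOne p.1 p.2.1 p.2.2)
      {p | WatsonRegular (-1) 1 p.1 p.2.1 p.2.2 ∧ ¬ IsNonposInt p.1} := by
  rintro ⟨a, b, c⟩ ⟨⟨he, hf, hs⟩, ha⟩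
  simp only [watsonExcess, watsonE, watsonF] at he hf hs ha
  push_cast at he hf hs
  have h1 : ¬ IsNonposInt (a / 2) := not_isNonposInt_of_two_mul ha (by ring)
  have h2 : ¬ IsNonposInt (a / 2 + 1 / 2) := not_isNonposInt_of_two_mul_sub_one ha (by ring)
  have h3 : ¬ IsNonposInt (a / 2 + b / 2) := by convert he using 2; ring
  have h4 : ¬ IsNonposInt (1 + 2 * c) := by convert hf using 2; ring
  have h5 : ¬ IsNonposInt (1 + c - a / 2 - b / 2) := by convert hs using 2; ring
  have heq : (fun p : ℂ × ℂ × ℂ => watsonNegOneOne p.1 p.2.1 p.2.2) = fun p =>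
      (Gamma (p.1 / 2) * ((Gamma (1 + p.2.2 - p.2.1 / 2))⁻¹ *
          (Gamma (p.2.2 - p.1 / 2 + 1 / 2))⁻¹ * (Gamma (p.2.1 / 2))⁻¹) +
        Gamma (p.1 / 2 + 1 / 2) * ((Gamma (1 / 2 + p.2.2 - p.2.1 / 2))⁻¹ *
          (Gamma (p.2.2 - p.1 / 2 + 1))⁻¹ * (Gamma (p.2.1 / 2 + 1 / 2))⁻¹)) *
      ((Real.sqrt Real.pi : ℂ) * Gamma (p.1 / 2 + p.2.1 / 2) * Gamma (1 + 2 * p.2.2) *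
        Gamma (1 + p.2.2 - p.1 / 2 - p.2.1 / 2)) *
      (((2 : ℂ) ^ (1 + 2 * p.2.2 - p.1))⁻¹ * (Gamma (p.2.2 + 1))⁻¹ * (Gamma p.1)⁻¹) := by
    funext p
    rw [watsonNegOneOne, div_eq_mul_inv _ (_ * Gamma p.1), div_eq_mul_inv (Gamma (p.1 / 2)),
      div_eq_mul_inv (Gamma (p.1 / 2 + 1 / 2))]
    simp only [mul_inv]
  rw [heq]
  refine .fun_mul (.fun_mul (.fun_add
      (.fun_mul (.complex_Gamma ?_ h1) (.fun_mul (.fun_mul (.complex_Gamma_inv ?_)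
        (.complex_Gamma_inv ?_)) (.complex_Gamma_inv ?_)))
      (.fun_mul (.complex_Gamma ?_ h2) (.fun_mul (.fun_mul (.complex_Gamma_inv ?_)
        (.complex_Gamma_inv ?_)) (.complex_Gamma_inv ?_))))
    (.fun_mul (.fun_mul (.fun_mul analyticAt_const (.complex_Gamma ?_ h3)) (.complex_Gamma ?_ h4))
      (.complex_Gamma ?_ h5)))
    (.fun_mul (.fun_mul (.fun_inv (.two_cpow ?_) (by simp)) (.complex_Gamma_inv ?_))
      (.complex_Gamma_inv ?_))
  all_goals fun_prop

theorem analyticOnNhd_watsonOneZero :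
    AnalyticOnNhd ℂ (fun p : ℂ × ℂ × ℂ => watsonOneZero p.1 p.2.1 p.2.2)
      {p | WatsonRegular 1 0 p.1 p.2.1 p.2.2 ∧ ¬ IsNonposInt p.1 ∧
        ¬ IsNonposInt (2 * p.2.2 - p.1) ∧ p.1 ≠ p.2.1 ∧ p.1 + p.2.1 ≠ 2 * p.2.2} := by
  rintro ⟨a, b, c⟩ ⟨⟨he, hf, hs⟩, ha, hca, hab, habc⟩
  simp only [watsonExcess, watsonE, watsonF] at he hf hs ha hca hab habc
  push_cast at he hf hs
  have h1 : ¬ IsNonposInt (a / 2) := not_isNonposInt_of_two_mul ha (by ring)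
  have h2 : ¬ IsNonposInt (a / 2 + 1 / 2) := not_isNonposInt_of_two_mul_sub_one ha (by ring)
  have h3 : ¬ IsNonposInt (c - a / 2) := not_isNonposInt_of_two_mul hca (by ring)
  have h4 : ¬ IsNonposInt (1 / 2 - a / 2 + c) := not_isNonposInt_of_two_mul_sub_one hca (by ring)
  have h5 : ¬ IsNonposInt (1 + a / 2 + b / 2) := by convert he using 2; ring
  have h6 : ¬ IsNonposInt (2 * c) := by convert hf using 2; ring
  have h7 : ¬ IsNonposInt (1 + c - a / 2 - b / 2) := by convert hs using 2; ring
  have h8 : b / 2 - a / 2 ≠ 0 := fun h => hab (by linear_combination -2 * h)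
  have h9 : c - a / 2 - b / 2 ≠ 0 := fun h => habc (by linear_combination -2 * h)
  have heq : (fun p : ℂ × ℂ × ℂ => watsonOneZero p.1 p.2.1 p.2.2) = fun p =>
      (1 / 2 * (Gamma (p.2.2 - p.1 / 2) * Gamma (p.1 / 2) *
          ((Gamma (p.2.2 - p.2.1 / 2))⁻¹ * (Gamma (p.2.1 / 2))⁻¹)) -
        1 / 2 * (Gamma (1 / 2 - p.1 / 2 + p.2.2) * Gamma (p.1 / 2 + 1 / 2) *
          ((Gamma (1 / 2 - p.2.1 / 2 + p.2.2))⁻¹ * (Gamma (p.2.1 / 2 + 1 / 2))⁻¹))) *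
      Gamma (1 + p.1 / 2 + p.2.1 / 2) * Gamma (2 * p.2.2) *
        Gamma (1 + p.2.2 - p.1 / 2 - p.2.1 / 2) *
      ((Gamma (2 * p.2.2 - p.1))⁻¹ * (Gamma p.2.2)⁻¹ * (Gamma p.1)⁻¹ *
        (p.2.1 / 2 - p.1 / 2)⁻¹ * (p.2.2 - p.1 / 2 - p.2.1 / 2)⁻¹) := by
    funext p
    rw [watsonOneZero, div_eq_mul_inv _ (_ * (p.2.2 - p.1 / 2 - p.2.1 / 2)),
      div_eq_mul_inv (Gamma (p.2.2 - p.1 / 2) * _), div_eq_mul_inv (_ * Gamma (p.1 / 2 + 1 / 2))]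
    simp only [mul_inv]
  rw [heq]
  refine .fun_mul (.fun_mul (.fun_mul (.fun_mul (.fun_sub
      (.fun_mul analyticAt_const (.fun_mul (.fun_mul (.complex_Gamma ?_ h3) (.complex_Gamma ?_ h1))
        (.fun_mul (.complex_Gamma_inv ?_) (.complex_Gamma_inv ?_))))
      (.fun_mul analyticAt_const (.fun_mul (.fun_mul (.complex_Gamma ?_ h4) (.complex_Gamma ?_ h2))
        (.fun_mul (.complex_Gamma_inv ?_) (.complex_Gamma_inv ?_)))))
      (.complex_Gamma ?_ h5)) (.complex_Gamma ?_ h6)) (.complex_Gamma ?_ h7))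
    (.fun_mul (.fun_mul (.fun_mul (.fun_mul (.complex_Gamma_inv ?_) (.complex_Gamma_inv ?_))
      (.complex_Gamma_inv ?_)) (.fun_inv ?_ h8)) (.fun_inv ?_ h9))
  all_goals fun_prop

theorem analyticOnNhd_watsonOneNegOne :
    AnalyticOnNhd ℂ (fun p : ℂ × ℂ × ℂ => watsonOneNegOne p.1 p.2.1 p.2.2)
      {p | WatsonRegular 1 (-1) p.1 p.2.1 p.2.2 ∧ ¬ IsNonposInt (p.1 + 1) ∧
        ¬ IsNonposInt (2 * p.2.2 - p.2.1) ∧ p.1 ≠ p.2.1} := by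
  rintro ⟨a, b, c⟩ ⟨⟨he, hf, hs⟩, ha, hcb, hab⟩
  simp only [watsonExcess, watsonE, watsonF] at he hf hs ha hcb hab
  push_cast at he hf hs
  have h1 : ¬ IsNonposInt (a / 2 + 1 / 2) := not_isNonposInt_of_two_mul ha (by ring)
  have h2 : ¬ IsNonposInt (1 + a / 2) := not_isNonposInt_of_two_mul_sub_one ha (by ring)
  have h3 : ¬ IsNonposInt (c - b / 2) := not_isNonposInt_of_two_mul hcb (by ring)
  have h4 : ¬ IsNonposInt (c - b / 2 + 1 / 2) := not_isNonposInt_of_two_mul_sub_one hcb (by ring)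
  have h5 : ¬ IsNonposInt (1 + a / 2 + b / 2) := by convert he using 2; ring
  have h6 : ¬ IsNonposInt (c - 1 / 2) := not_isNonposInt_of_two_mul hf (by ring)
  have h7 : ¬ IsNonposInt (c - a / 2 - b / 2) := by convert hs using 2; ring
  have h8 : b / 2 - a / 2 ≠ 0 := fun h => hab (by linear_combination -2 * h)
  have heq : (fun p : ℂ × ℂ × ℂ => watsonOneNegOne p.1 p.2.1 p.2.2) = fun p =>
      (-(1 / 4) * (p.1 * (2 * p.2.2 - p.2.1 - 1) * Gamma (p.2.2 - p.2.1 / 2) *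
          Gamma (p.1 / 2 + 1 / 2) *
          ((Gamma (p.2.2 - p.1 / 2))⁻¹ * (Gamma (p.2.1 / 2 + 1 / 2))⁻¹)) +
        Gamma (1 + p.1 / 2) * Gamma (p.2.2 - p.2.1 / 2 + 1 / 2) *
          ((Gamma (p.2.2 - p.1 / 2 - 1 / 2))⁻¹ * (Gamma (p.2.1 / 2))⁻¹)) *
      Gamma (1 + p.1 / 2 + p.2.1 / 2) * Gamma (p.2.2 - p.1 / 2 - p.2.1 / 2) *
        Gamma (p.2.2 - 1 / 2) * (2 : ℂ) ^ (p.1 - p.2.1 + 2 * p.2.2 - 1) *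
      ((Real.sqrt Real.pi : ℂ)⁻¹ * (Gamma (p.1 + 1))⁻¹ * (Gamma (2 * p.2.2 - p.2.1))⁻¹ *
        (p.2.1 / 2 - p.1 / 2)⁻¹) := by
    funext p
    rw [watsonOneNegOne, div_eq_mul_inv _ (_ * (p.2.1 / 2 - p.1 / 2)),
      div_eq_mul_inv (_ * Gamma (p.1 / 2 + 1 / 2)),
      div_eq_mul_inv (_ * Gamma (p.2.2 - p.2.1 / 2 + 1 / 2))]
    simp only [mul_inv]
  rw [heq]
  refine .fun_mul (.fun_mul (.fun_mul (.fun_mul (.fun_mul (.fun_add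
      (.fun_mul analyticAt_const (.fun_mul (.fun_mul (.fun_mul ?_ (.complex_Gamma ?_ h3))
        (.complex_Gamma ?_ h1)) (.fun_mul (.complex_Gamma_inv ?_) (.complex_Gamma_inv ?_))))
      (.fun_mul (.fun_mul (.complex_Gamma ?_ h2) (.complex_Gamma ?_ h4))
        (.fun_mul (.complex_Gamma_inv ?_) (.complex_Gamma_inv ?_))))
      (.complex_Gamma ?_ h5)) (.complex_Gamma ?_ h7)) (.complex_Gamma ?_ h6)) (.two_cpow ?_))
    (.fun_mul (.fun_mul (.fun_mul analyticAt_const (.complex_Gamma_inv ?_))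
      (.complex_Gamma_inv ?_)) (.fun_inv ?_ h8))
  all_goals fun_prop

/-! ### The four evaluations -/

theorem mainTheorem1 :
    WatsonEvaluation 0 (-1)
      (fun a b c => WatsonRegular 0 (-1) a b c)
      watsonZeroNegOne ∧
    WatsonEvaluation (-1) 1
      (fun a b c => WatsonRegular (-1) 1 a b c ∧ ¬ IsNonposInt a)
      watsonNegOneOne ∧
    WatsonEvaluation 1 0
      (fun a b c => WatsonRegular 1 0 a b c ∧ ¬ IsNonposInt a ∧ ¬ IsNonposInt (2 * c - a) ∧
        a ≠ b ∧ a + b ≠ 2 * c)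
      watsonOneZero ∧
    WatsonEvaluation 1 (-1)
      (fun a b c => WatsonRegular 1 (-1) a b c ∧ ¬ IsNonposInt (a + 1) ∧
        ¬ IsNonposInt (2 * c - b) ∧ a ≠ b)
      watsonOneNegOne := by
  -- `(1, 1 / 2, 10)` satisfies all conditions, since all expressions in question are positive there
  have reg : ∀ m n : ℤ, -1 ≤ m → -1 ≤ n → WatsonRegular m n 1 (1 / 2) 10 ∧
      0 < (watsonExcess m n 1 (1 / 2) 10).re := by
    intro m n hm hn
    have hm' : (-1 : ℝ) ≤ m := by exact_mod_cast hm
    have hn' : (-1 : ℝ) ≤ n := by exact_mod_cast hn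
    have hs : 0 < (watsonExcess m n 1 (1 / 2) 10).re := by
      simp [watsonExcess, watsonE, watsonF]
      norm_num
      linarith
    refine ⟨⟨not_isNonposInt_of_re_pos ?_, not_isNonposInt_of_re_pos ?_,
      not_isNonposInt_of_re_pos hs⟩, hs⟩
    · simp [watsonE]
      norm_num
      linarith
    · simp [watsonF]
      norm_num
      linarith
  have ga : LineGeneric {p | ¬ IsNonposInt p.1} := by
    convert lineGeneric_not_isNonposInt 1 0 0 0 using 5
    ring
  refine ⟨?_, ?_, ?_, ?_⟩
  · refine watsonEvaluation_of_base (B := 2) (lineGeneric_watsonRegular 0 (-1))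
      (fun a b c h => h) analyticOnNhd_watsonZeroNegOne
      ⟨1, 1 / 2, 10, reg 0 (-1) (by norm_num) (by norm_num)⟩ ?_
    intro a b c h ha hb hc
    rw [← tsum_watson_zero_negOne (e := watsonE 0 a b) (by simp [watsonE]; ring) h.1
      (by linarith) (by linarith) (by linarith)]
    simp [watsonW, watsonTerm, watsonF, sub_eq_add_neg]
  · refine watsonEvaluation_of_base (B := 2) ((lineGeneric_watsonRegular (-1) 1).inter ga)
      (fun a b c h => h.1) analyticOnNhd_watsonNegOneOne
      ⟨1, 1 / 2, 10, ⟨(reg (-1) 1 (by norm_num) (by norm_num)).1,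
        not_isNonposInt_of_re_pos (by simp)⟩, (reg (-1) 1 (by norm_num) (by norm_num)).2⟩ ?_
    intro a b c h ha hb hc
    rw [← tsum_watson_negOne_one (e := watsonE (-1) a b) (by simp [watsonE]; ring) h.1.1 h.2
      ha hb (by linarith)]
    simp [watsonW, watsonTerm, watsonF]
  · have g2 : LineGeneric {p | ¬ IsNonposInt (2 * p.2.2 - p.1)} := by
      convert lineGeneric_not_isNonposInt (-1) 0 2 0 using 5
      ring
    have g3 : LineGeneric {p | p.1 ≠ p.2.1} := by
      convert lineGeneric_ne_zero 1 (-1) 0 0 using 1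
      ext p
      simp only [Set.mem_ofPred_eq, ne_eq, not_iff_not]
      constructor <;> intro h <;> linear_combination h
    have g4 : LineGeneric {p | p.1 + p.2.1 ≠ 2 * p.2.2} := by
      convert lineGeneric_ne_zero 1 1 (-2) 0 using 1
      ext p
      simp only [Set.mem_ofPred_eq, ne_eq, not_iff_not]
      constructor <;> intro h <;> linear_combination h
    refine watsonEvaluation_of_base (B := 2)
      ((lineGeneric_watsonRegular 1 0).inter (ga.inter (g2.inter (g3.inter g4))))
      (fun a b c h => h.1) analyticOnNhd_watsonOneZero
      ⟨1, 1 / 2, 10, ⟨(reg 1 0 (by norm_num) (by norm_num)).1,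
        not_isNonposInt_of_re_pos (by simp), not_isNonposInt_of_re_pos (by norm_num),
        by norm_num, by norm_num⟩, (reg 1 0 (by norm_num) (by norm_num)).2⟩ ?_
    intro a b c h ha hb hc
    rw [← tsum_watson_one_zero (e := watsonE 1 a b) (by simp [watsonE]; ring) h.1.1 h.2.1 h.2.2.1
      h.2.2.2.1 ha hb (by linarith)]
    simp [watsonW, watsonTerm, watsonF]
  · have g1 : LineGeneric {p | ¬ IsNonposInt (p.1 + 1)} := by
      convert lineGeneric_not_isNonposInt 1 0 0 1 using 5
      ring
    have g2 : LineGeneric {p | ¬ IsNonposInt (2 * p.2.2 - p.2.1)} := by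
      convert lineGeneric_not_isNonposInt 0 (-1) 2 0 using 5
      ring
    have g3 : LineGeneric {p | p.1 ≠ p.2.1} := by
      convert lineGeneric_ne_zero 1 (-1) 0 0 using 1
      ext p
      simp only [Set.mem_ofPred_eq, ne_eq, not_iff_not]
      constructor <;> intro h <;> linear_combination h
    refine watsonEvaluation_of_base (B := 2)
      ((lineGeneric_watsonRegular 1 (-1)).inter (g1.inter (g2.inter g3)))
      (fun a b c h => h.1) analyticOnNhd_watsonOneNegOne
      ⟨1, 1 / 2, 10, ⟨(reg 1 (-1) (by norm_num) (by norm_num)).1,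
        not_isNonposInt_of_re_pos (by simp), not_isNonposInt_of_re_pos (by norm_num),
        by norm_num⟩, (reg 1 (-1) (by norm_num) (by norm_num)).2⟩ ?_
    intro a b c h ha hb hc
    rw [← tsum_watson_one_negOne (e := watsonE 1 a b) (by simp [watsonE]; ring) h.1.1 h.2.1
      h.2.2.1 h.2.2.2 ha hb (by linarith)]
    simp [watsonW, watsonTerm, watsonF, sub_eq_add_neg]
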